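/- **Setting.** Let $G=(V,E)$ be a strongly connected directed multigraph with $n=|V|$, $m=|E|$, $n\le m$, $m\ge 2$, and let $b:V\to\mathbb R$ satisfy $\sum_i b_i=0$. Consider $\min\sum_{ij\in E}C_{ij}(f_{ij})$ subject to $\rho_f=b$, $f\ge 0$, where $\rho_f(i)$ is the inflow minus the outflow of $f$ at $i$. Each $C_{ij}$ is convex and either linear or strictly convex (affine functions count as linear). Each arc is either *free* ($C_{ij}$ is differentiable on $\mathbb R$) or *restricted* ($C_{ij}=\infty$ on $(-\infty,0)$, $C_{ij}$ is finite and continuous on $[0,\infty)$, differentiable on $(0,\infty)$, with right derivative $-\infty$ at $0$; put $C'_{ij}=-\infty$ on $(-\infty,0]$). Let $m_N$ be the number of nonlinear arcs. For $ij\in E$ the reversed arc $ji$ has $f_{ji}=-f_{ij}$ and $C_{ji}(\alpha)=C_{ij}(-\alpha)$; for $F\subseteq E$ let $\overleftarrow F$ be the set of reversals. Let $Ex_b(f)=\sum_i\max\{\rho_f(i)-b_i,0\}$, $E_f^F=E\cup\overleftarrow F\cup\{ji: ij\in E,f_{ij}>0\}$ and $E_f^F(\Delta)=E\cup\overleftarrow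 F\cup\{ji: ij\in E,f_{ij}\ge\Delta\}$. For $f:E\to\mathbb R$ nonnegative on $E\setminus F$ and $\pi:V\to\mathbb R$: * $f$ is $(\Delta,F)$-*feasible* (with potential $\pi$), $\Delta>0$, if $\pi_j-\pi_i\le C'_{ij}(f_{ij}+\Delta)$ on $E_f^F(\Delta)$; $err_F(f)=\inf\{\Delta>0: f\text{ is }(\Delta,F)\text{-feasible}\}\in[0,\infty]$. * $f$ is $F$-*optimal* if $Ex_b(f)=0$ and some $\pi$ satisfies $\pi_j-\pi_i\le C'_{ij}(f_{ij})$ on $E^F_f$. * $F^*$ is the set of arcs $ij$ with $\pi_j-\pi_i=C'_{ij}(f_{ij})$ for every feasible solution $f$ and every $\pi$ with $\pi_j-\pi_i\le C'_{ij}(f_{ij})$ on $E_f^\emptyset$. * $x:E\to\mathbb R$ is $F$-*tight* if $x=0$ outside $F$ and some $\pi$ satisfies $\pi_j-\pi_i=C'_{ij}(x_{ij})$ on $F$. * $F$ is *linear acyclic* if it contains no undirected cycle of linear arcs. $D_{b}(F)$ is the maximum of $|\sum_{i\in K}b_i|$ over the undirected connected components $K$ of $(V,F)$. Assume that for every linear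 acyclic $F$ and every $\hat b:V\to\mathbb R$ with $D_{\hat b}(F)=0$ there is an $F$-tight $x$ with $\rho_x=\hat b$. **Enhanced algorithm.** Start with $f=0$, $F=\emptyset$, $\Delta=\max\{err_\emptyset(0),Ex_b(0)/(2n+m_N)\}$; stop at once if $\Delta\in\{0,\infty\}$. A *scaling phase* with parameter $\Delta$ consists of the following. 1. *Main part.* While $S=\{i:\rho_f(i)-b_i\ge\Delta\}$ and $T'=\{i:\rho_f(i)-b_i\le-\Delta\}$ are both nonempty, send $\Delta$ units along a shortest path in $E^F_f(\Delta)$, for the cost $C'_{ij}(f_{ij}+\Delta)$, from a node of $S$ to a node of $T'$. 2. *Extend.* For each $ij\in E\setminus F$ with $f_{ij}>(2n+m+1)\Delta$, one after the other: if $F\cup\{ij\}$ is linear acyclic, add $ij$ to $F$; otherwise send $f_{ij}$ units from $i$ to $j$ along a path of linear arcs of $F$ and their reversals, and set $f_{ij}=0$. 3. If $F$ was extended and $D_b(F)\le\Delta$, perform *Trial-and-Error*: in each component $K$ of $(V,F)$ pick a node and lower its demand by $\sum_{i\in K}b_i$, which gives $\hat b$; find an $F$-tight $\hat f$ with $\rho_{\hat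 f}=\hat b$. If $\hat b=b$ and $err_F(\hat f)=0$, terminate with $\hat f$. Otherwise, if $err_F(\hat f)<\Delta/2$, continue with $f=\hat f$ and scaling factor $\max\{err_F(\hat f),Ex_b(\hat f)/(2n+m_N)\}$. 4. In all other cases perform *Adjust* and halve $\Delta$: take $\pi$ certifying that $f$ is $(\Delta,F)$-feasible and, on each arc $ij\in E$, replace $f_{ij}$ by $f_{ij}+\Delta/2$ if $C'_{ij}(f_{ij}+\Delta/2)<\pi_j-\pi_i$, and by $f_{ij}-\Delta/2$ if ($f_{ij}\ge\Delta/2$ or $ij\in F$) and $\pi_j-\pi_i<C'_{ij}(f_{ij}-\Delta/2)$. All choices left open are arbitrary. **Theorem.** There is an absolute constant $C$ such that for all such problems the following holds. 1. Every execution has at most $C\,(n+m_N)\log m$ scaling phases. In each phase the main part is finite, and both the main part and the phase can always be continued and completed, so the algorithm terminates; if the initial $\Delta$ is finite, it terminates with an $F$-optimal vector for its final set $F$. 2. $F\subseteq F^*$ throughout, $F$ is extended in at most $n+m_N-1$ phases, and in any $2\lceil\log_2 T\rceil$ consecutive phases of an execution, where $T=8(2n+m+4)m$, a new arc enters $F$.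 3. Whenever Trial-and-Error is performed in a phase with scaling factor $\Delta$, $err_F(\hat f)\le 2(2n+m+4)m\Delta$. 4. If $F\subseteq E$ is linear acyclic and $x,y$ are $F$-tight, then $\|x-y\|_\infty\le\|\rho_x-\rho_y\|_1$. -/

import Mathlib

open Set Filter Topology

universe u v

noncomputable section

/-- The data of an uncapacitated minimum-cost flow problem on a directed multigraph with node set `V`
and arc set `E`. The separable cost of a free arc `e` is `cost e : ℝ → ℝ`; the cost of a restricted
arc is `cost e` on `[0, ∞)` and `+∞` on `(-∞, 0)`, whatever the values of `cost e` there. -/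
structure FlowNetwork (V : Type u) (E : Type v) where
  src : E → V
  tgt : E → V
  demand : V → ℝ
  restricted : Set E
  cost : E → ℝ → ℝ

namespace FlowNetwork

variable {V : Type u} {E : Type v} [Fintype V] [Fintype E] (N : FlowNetwork V E)

/-! ### Costs and standing assumptions -/

/-- A linear arc: the derivative of its cost is constant. -/
def IsLinear (e : E) : Prop :=
  e ∉ N.restricted ∧ ∃ a c : ℝ, ∀ α : ℝ, N.cost e α = a * α + c

open scoped Classical in
/-- The derivative `C'ₑ(α)` of the cost, equal to `-∞` on `(-∞, 0]` for restricted arcs. -/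
def dcost (e : E) (α : ℝ) : EReal :=
  if e ∈ N.restricted ∧ α ≤ 0 then ⊥ else ((deriv (N.cost e) α : ℝ) : EReal)

/-- Admissible cost of a free arc: convex and differentiable on `ℝ`, and linear or strictly convex. -/
def FreeCost (e : E) : Prop :=
  ConvexOn ℝ univ (N.cost e) ∧ Differentiable ℝ (N.cost e) ∧
    ((∃ a c : ℝ, ∀ α : ℝ, N.cost e α = a * α + c) ∨ StrictConvexOn ℝ univ (N.cost e))

/-- Admissible cost of a restricted arc: strictly convex and continuous on `[0, ∞)`, differentiable
on `(0, ∞)`, with right derivative `-∞` at `0`. -/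
def RestrictedCost (e : E) : Prop :=
  StrictConvexOn ℝ (Ici 0) (N.cost e) ∧ ContinuousOn (N.cost e) (Ici 0) ∧
    (∀ α : ℝ, 0 < α → DifferentiableAt ℝ (N.cost e) α) ∧
    Tendsto (fun α : ℝ => (N.cost e α - N.cost e 0) / α) (𝓝[>] 0) atBot

/-- Number of nonlinear arcs. -/
def numNonlinear : ℕ := Set.ncard {e : E | ¬ N.IsLinear e}

/-- The standing assumptions on the problem. -/
structure Standing : Prop where
  balanced : ∑ i, N.demand i = 0
  stronglyConnected :
    ∀ i j : V, Relation.ReflTransGen (fun a b => ∃ e : E, N.src e = a ∧ N.tgt e = b) i j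
  card_le : Fintype.card V ≤ Fintype.card E
  two_le : 2 ≤ Fintype.card E
  free : ∀ e, e ∉ N.restricted → N.FreeCost e
  restr : ∀ e, e ∈ N.restricted → N.RestrictedCost e

/-! ### Flows -/

open scoped Classical in
/-- Net inflow `ρ_f(i)`. -/
def netInflow (f : E → ℝ) (i : V) : ℝ :=
  (∑ e with N.tgt e = i, f e) - ∑ e with N.src e = i, f e

/-- Total positive excess `Ex_b(f)`. -/
def excess (b : V → ℝ) (f : E → ℝ) : ℝ := ∑ i, max (N.netInflow f i - b i) 0

/-! ### Forward and backward arcs, walks, paths, cycles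

`(e, true)` is the arc `e` itself and `(e, false)` its reversal. -/

def dsrc (d : E × Bool) : V := if d.2 then N.src d.1 else N.tgt d.1

def dtgt (d : E × Bool) : V := if d.2 then N.tgt d.1 else N.src d.1

/-- `p` is a walk from `i` to `j`. -/
def IsWalk : V → List (E × Bool) → V → Prop
  | i, [], j => i = j
  | i, d :: p, j => N.dsrc d = i ∧ IsWalk (N.dtgt d) p j

/-- A walk without repeated nodes. -/
def IsPath (i : V) (p : List (E × Bool)) (j : V) : Prop :=
  N.IsWalk i p j ∧ (i :: p.map N.dtgt).Nodup

/-- An undirected cycle: a nonempty closed walk without repeated nodes or arcs. -/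
def IsCycle (p : List (E × Bool)) : Prop :=
  p ≠ [] ∧ (∃ i, N.IsWalk i p i) ∧ (p.map N.dtgt).Nodup ∧ (p.map Prod.fst).Nodup

/-- `F` contains no undirected cycle of linear arcs. -/
def LinearAcyclic (F : Set E) : Prop :=
  ¬ ∃ p : List (E × Bool), N.IsCycle p ∧ ∀ d ∈ p, d.1 ∈ F ∧ N.IsLinear d.1

open scoped Classical in
/-- Send `δ` units of flow along `p`. -/
def push (f : E → ℝ) (p : List (E × Bool)) (δ : ℝ) : E → ℝ := fun e =>
  f e + (p.map fun d => if d.1 = e then (if d.2 then δ else -δ) else 0).sum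

/-! ### Residual graphs, feasibility and optimality -/

/-- The cost `C'(f + Δ)` of a forward or backward arc; on the reversal of `e` the flow is `-fₑ` and
the cost function is `α ↦ Cₑ(-α)`. -/
def dartCost (f : E → ℝ) (Δ : ℝ) (d : E × Bool) : EReal :=
  if d.2 then N.dcost d.1 (f d.1 + Δ) else - N.dcost d.1 (f d.1 - Δ)

/-- The residual graph `E_f^F`. -/
def residual (_N : FlowNetwork V E) (F : Set E) (f : E → ℝ) : Set (E × Bool) :=
  {d | d.2 = true ∨ d.1 ∈ F ∨ 0 < f d.1}

/-- The `Δ`-residual graph `E_f^F(Δ)`. -/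
def residualAt (_N : FlowNetwork V E) (F : Set E) (f : E → ℝ) (Δ : ℝ) : Set (E × Bool) :=
  {d | d.2 = true ∨ d.1 ∈ F ∨ Δ ≤ f d.1}

/-- `f` is nonnegative outside `F`. -/
def IsPseudoflow (_N : FlowNetwork V E) (F : Set E) (f : E → ℝ) : Prop := ∀ e, e ∉ F → 0 ≤ f e

/-- `π` certifies `(Δ, F)`-feasibility of `f`. -/
def FeasiblePotential (F : Set E) (f : E → ℝ) (Δ : ℝ) (π : V → ℝ) : Prop :=
  ∀ d ∈ N.residualAt F f Δ, ((π (N.dtgt d) - π (N.dsrc d) : ℝ) : EReal) ≤ N.dartCost f Δ d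

/-- `(Δ, F)`-feasibility. -/
def Feasible (F : Set E) (f : E → ℝ) (Δ : ℝ) : Prop :=
  N.IsPseudoflow F f ∧ ∃ π : V → ℝ, N.FeasiblePotential F f Δ π

/-- The optimality condition on `E_f^F` for the pair `(f, π)`. -/
def OptPotential (F : Set E) (f : E → ℝ) (π : V → ℝ) : Prop :=
  ∀ d ∈ N.residual F f, ((π (N.dtgt d) - π (N.dsrc d) : ℝ) : EReal) ≤ N.dartCost f 0 d

/-- `F`-optimality. -/
def FOptimal (F : Set E) (f : E → ℝ) : Prop :=
  N.IsPseudoflow F f ∧ N.excess N.demand f = 0 ∧ ∃ π : V → ℝ, N.OptPotential F f π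

/-- `f` is a feasible solution and `(f, π)` satisfies the Karush-Kuhn-Tucker conditions. -/
def IsOptimalPair (f : E → ℝ) (π : V → ℝ) : Prop :=
  (∀ e, 0 ≤ f e) ∧ (∀ i, N.netInflow f i = N.demand i) ∧ N.OptPotential ∅ f π

/-- `F*`: the arcs that are tight in every optimal solution. -/
def tightArcs : Set E :=
  {e | ∀ f π, N.IsOptimalPair f π →
    ((π (N.tgt e) - π (N.src e) : ℝ) : EReal) = N.dcost e (f e)}

/-- `F`-tight vectors. -/
def IsTight (F : Set E) (x : E → ℝ) : Prop :=
  (∀ e, e ∉ F → x e = 0) ∧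
    ∃ π : V → ℝ, ∀ e ∈ F, ((π (N.tgt e) - π (N.src e) : ℝ) : EReal) = N.dcost e (x e)

/-- `err_F(f)`, with value `⊤` if `f` is not `(Δ, F)`-feasible for any `Δ > 0`. -/
def err (F : Set E) (f : E → ℝ) : EReal :=
  sInf {t : EReal | ∃ Δ : ℝ, 0 < Δ ∧ N.Feasible F f Δ ∧ t = (Δ : EReal)}

/-! ### Components, discrepancy and the trial system -/

/-- `i` and `j` lie in the same undirected connected component of `F`. -/
def Conn (F : Set E) (i j : V) : Prop :=
  Relation.EqvGen (fun a b => ∃ e ∈ F, N.src e = a ∧ N.tgt e = b) i j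

open scoped Classical in
/-- Sum of `b` over the component of `i`. -/
def compSum (b : V → ℝ) (F : Set E) (i : V) : ℝ := ∑ j with N.Conn F i j, b j

/-- The discrepancy `D_b(F)`. -/
def discrepancy (b : V → ℝ) (F : Set E) : ℝ := ⨆ i : V, |N.compSum b F i|

/-- `x` is an `F`-tight vector that satisfies the demands `b'`. -/
def IsTrial (F : Set E) (b' : V → ℝ) (x : E → ℝ) : Prop :=
  N.IsTight F x ∧ ∀ i, N.netInflow x i = b' i

/-- The trial system has a solution whenever `F` is linear acyclic and the discrepancy is zero. -/
def TrialSolvable : Prop :=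
  ∀ (F : Set E) (b' : V → ℝ), N.LinearAcyclic F → N.discrepancy b' F = 0 → ∃ x, N.IsTrial F b' x

open scoped Classical in
/-- `b'` arises from the demands by picking a node `r` in each component `K` of `F` and changing the
demand of that node by `-∑ i ∈ K, b i`. -/
def IsCorrection (F : Set E) (b' : V → ℝ) : Prop :=
  ∃ r : V → V, (∀ i, N.Conn F i (r i)) ∧ (∀ i j, N.Conn F i j → r i = r j) ∧
    ∀ i, b' i = N.demand i - if r i = i then N.compSum N.demand F i else 0

/-! ### The enhanced algorithm

All choices that the algorithm leaves open (terminals, shortest path, potential, order in which arcs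
are processed, corrected demands, solution of the trial system) are arbitrary. -/

/-- Flow `f`, scaling factor `Δ`, revealed arc set `F`. -/
structure State (E : Type v) where
  flow : E → ℝ
  scale : ℝ
  revealed : Set E

/-- `S(Δ)`. -/
def sources (s : State E) : Set V := {i | s.scale ≤ N.netInflow s.flow i - N.demand i}

/-- `T(Δ)`. -/
def sinks (s : State E) : Set V := {i | N.netInflow s.flow i - N.demand i ≤ -s.scale}

/-- `p` is a shortest path from `i` to `j` in `E_f^F(Δ)` for the cost `C'(f + Δ)`. -/
def IsShortestPath (s : State E) (i : V) (p : List (E × Bool)) (j : V) : Prop :=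
  (N.IsPath i p j ∧ ∀ d ∈ p, d ∈ N.residualAt s.revealed s.flow s.scale) ∧
    ∀ q, N.IsPath i q j → (∀ d ∈ q, d ∈ N.residualAt s.revealed s.flow s.scale) →
      (p.map (N.dartCost s.flow s.scale)).sum ≤ (q.map (N.dartCost s.flow s.scale)).sum

/-- One augmentation of the main part. -/
def Augment (s s' : State E) : Prop :=
  ∃ i ∈ N.sources s, ∃ j ∈ N.sinks s, ∃ p, N.IsShortestPath s i p j ∧
    s' = ⟨push s.flow p s.scale, s.scale, s.revealed⟩

/-- The main part is finished. -/
def MainDone (s : State E) : Prop := N.sources s = ∅ ∨ N.sinks s = ∅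

open scoped Classical in
/-- The loop of `Extend`, processing a list of arcs one by one. -/
inductive ExtendLoop : List E → (E → ℝ) → Set E → (E → ℝ) → Set E → Prop
  | nil (f : E → ℝ) (F : Set E) : ExtendLoop [] f F f F
  | add (e : E) (l : List E) (f f' : E → ℝ) (F F' : Set E) :
      N.LinearAcyclic (insert e F) → ExtendLoop l f (insert e F) f' F' →
      ExtendLoop (e :: l) f F f' F'
  | reroute (e : E) (l : List E) (f f' : E → ℝ) (F F' : Set E) (p : List (E × Bool)) :
      ¬ N.LinearAcyclic (insert e F) → N.IsPath (N.src e) p (N.tgt e) →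
      (∀ d ∈ p, d.1 ∈ F ∧ N.IsLinear d.1) →
      ExtendLoop l (Function.update (push f p (f e)) e 0) F f' F' →
      ExtendLoop (e :: l) f F f' F'

/-- Subroutine `Extend(Δ, f, F)`. -/
def Extend (s s' : State E) : Prop :=
  ∃ l : List E, l.Nodup ∧
    (∀ e, e ∈ l ↔ e ∉ s.revealed ∧
      (2 * Fintype.card V + Fintype.card E + 1 : ℝ) * s.scale < s.flow e) ∧
    N.ExtendLoop l s.flow s.revealed s'.flow s'.revealed ∧ s'.scale = s.scale

open scoped Classical in
/-- Subroutine `Adjust(δ, f, F)`, with result `f'`. -/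
def Adjust (δ : ℝ) (f : E → ℝ) (F : Set E) (f' : E → ℝ) : Prop :=
  ∃ π : V → ℝ, N.FeasiblePotential F f (2 * δ) π ∧
    ∀ e, f' e =
      if N.dcost e (f e + δ) < ((π (N.tgt e) - π (N.src e) : ℝ) : EReal) then f e + δ
      else if (δ ≤ f e ∨ e ∈ F) ∧
        ((π (N.tgt e) - π (N.src e) : ℝ) : EReal) < N.dcost e (f e - δ) then f e - δ
      else f e

/-- The algorithm is about to start a scaling phase, has terminated with a vector `f` claimed to be
`F`-optimal, or has stopped at the initialization because `err_∅(0) = ∞`. -/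
inductive Config (E : Type v) where
  | running (s : State E)
  | optimal (f : E → ℝ) (F : Set E)
  | unbounded

/-- The revealed arc set. -/
def Config.revealed : Config E → Set E
  | running s => s.revealed
  | optimal _ F => F
  | unbounded => ∅

/-- `max {err_F(f), Ex_b(f) / (2n + m_N)}`. -/
def startScale (F : Set E) (f : E → ℝ) : EReal :=
  max (N.err F f)
    ((N.excess N.demand f / (2 * Fintype.card V + N.numNonlinear : ℝ) : ℝ) : EReal)

/-- Initialization. If the initial scaling factor is `0`, the zero flow is already optimal. -/
inductive Initial : Config E → Prop
  | running (Δ : ℝ) : 0 < Δ → (Δ : EReal) = N.startScale ∅ 0 → Initial (.running ⟨0, Δ, ∅⟩)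
  | optimal : N.startScale ∅ 0 = 0 → Initial (.optimal 0 ∅)
  | unbounded : N.err ∅ 0 = ⊤ → Initial .unbounded

/-- `Trial-and-Error(F)` is performed: the revealed set was extended from that of `s` to that of `s'`
and its discrepancy is at most `Δ`. -/
def CallsTrial (s s' : State E) : Prop :=
  s'.revealed ≠ s.revealed ∧ N.discrepancy N.demand s'.revealed ≤ s'.scale

/-- The part of a phase after `Extend`, from the state `s'` that `Extend` returned when applied to `s`. -/
inductive AfterExtend (s s' : State E) : Config E → Prop
  | adjust (f : E → ℝ) :
      ¬ N.CallsTrial s s' → N.Adjust (s'.scale / 2) s'.flow s'.revealed f →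
      AfterExtend s s' (.running ⟨f, s'.scale / 2, s'.revealed⟩)
  | trialOptimal (b' : V → ℝ) (x : E → ℝ) :
      N.CallsTrial s s' → N.IsCorrection s'.revealed b' → N.IsTrial s'.revealed b' x →
      N.demand = b' → N.err s'.revealed x = 0 →
      AfterExtend s s' (.optimal x s'.revealed)
  | trialFailure (b' : V → ℝ) (x f : E → ℝ) :
      N.CallsTrial s s' → N.IsCorrection s'.revealed b' → N.IsTrial s'.revealed b' x →
      ((s'.scale / 2 : ℝ) : EReal) ≤ N.err s'.revealed x →
      N.Adjust (s'.scale / 2) s'.flow s'.revealed f →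
      AfterExtend s s' (.running ⟨f, s'.scale / 2, s'.revealed⟩)
  | trialSuccess (b' : V → ℝ) (x : E → ℝ) (Δ : ℝ) :
      N.CallsTrial s s' → N.IsCorrection s'.revealed b' → N.IsTrial s'.revealed b' x →
      ¬ (N.demand = b' ∧ N.err s'.revealed x = 0) →
      N.err s'.revealed x < ((s'.scale / 2 : ℝ) : EReal) →
      (Δ : EReal) = N.startScale s'.revealed x →
      AfterExtend s s' (.running ⟨x, Δ, s'.revealed⟩)

/-- The part of a phase after the main part. -/
def EndPhase (s : State E) (c : Config E) : Prop :=
  N.MainDone s ∧ ∃ s', N.Extend s s' ∧ N.AfterExtend s s' c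

/-- One scaling phase. -/
def Phase (c c' : Config E) : Prop :=
  ∃ s t : State E, c = .running s ∧ Relation.ReflTransGen N.Augment s t ∧ N.EndPhase t c'

/-- `c 0, …, c K` are the configurations between the first `K` scaling phases of an execution. -/
def IsRun (K : ℕ) (c : ℕ → Config E) : Prop :=
  N.Initial (c 0) ∧ ∀ k < K, N.Phase (c k) (c (k + 1))

/-- `⌈log₂ T⌉` for `T = 8 (2n + m + 4) m`. -/
def logT (_N : FlowNetwork V E) : ℕ :=
  ⌈Real.logb 2 (8 * (2 * Fintype.card V + Fintype.card E + 4) * Fintype.card E : ℝ)⌉₊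

end FlowNetwork

end

noncomputable section

namespace FlowNetwork

set_option linter.unusedSectionVars false

variable {V : Type u} {E : Type v} [Fintype V] [Fintype E] {N : FlowNetwork V E}

/-! ### Derivatives of the costs -/

/-! The algorithm always carries a potential certifying that the current `f` is `(Δ, F)`-feasible. A
push along a shortest path preserves this, since adding shortest path distances to the potential
makes every arc of the path tight. `Extend` preserves it because it reroutes flow over linear arcs
only, where the marginal cost is constant, and `Adjust` turns a certificate for `Δ` into one for
`Δ/2`. Each push lowers the excess by exactly `Δ`, so the main part stops, with excess at most `nΔ`.

An arc whose flow exceeds `Ex + mΔ` is tight at every optimum (`Standing.mem_tightArcs`). Otherwise,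
compare with an optimal pair and cut along a level set of the difference of the two potentials: each
arc contributes at least `-Δ` to the inflow of the cut and the given arc its whole flow, which is
more than the excess allows. Hence `F ⊆ F*`. Since `F` stays linear acyclic, its linear arcs form a
forest and `|F| ≤ n + m_N - 1`.

The difference of two `F`-tight vectors flows upwards in the difference of their potentials,
strictly so on nonlinear arcs. A cycle of this flow would therefore consist of linear arcs, so there
is none, and each arc carries at most the total imbalance
(`LinearAcyclic.abs_le_sum_abs_netInflow`). Comparing a trial vector with the tight vector read off
the current potential bounds its error (`Standing.err_trial_le`).

For the number of phases, `Invariant.progress` records that either `D_b(F) ≥ 2Δ` or some trial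
vector for `F` has error at least `Δ`. Suppose that `F` is unchanged for `2⌈log₂ T⌉` phases from
scale `Δ₀` on. No trial takes place and `Δ` is halved every time. By the last phase the flow on arcs
leaving a component of `F` is so small that `D_b(F) ≤ Δ₀ / 2^⌈log₂ T⌉`, which refutes the first
alternative. Halfway, the error bound applies to the recorded trial vector, although no trial is
made there, and refutes the second (`IsRun.ssubset`). -/

theorem continuousAt_deriv_of_strictMonoOn {g : ℝ → ℝ} {s : Set ℝ} (hs : IsOpen s)
    (hc : s.OrdConnected) (hd : ∀ x ∈ s, DifferentiableAt ℝ g x) (hm : StrictMonoOn (deriv g) s)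
    {a : ℝ} (ha : a ∈ s) : ContinuousAt (deriv g) a := by
  -- Darboux: derivatives have the intermediate value property, so a strictly monotone one cannot
  -- jump.
  have himg : (deriv g '' s).OrdConnected := hc.image_deriv hd
  obtain ⟨ε, hε, hball⟩ := Metric.isOpen_iff.1 hs a ha
  have h1 : a - ε / 2 ∈ s := hball (by rw [Metric.mem_ball, Real.dist_eq, abs_lt]; constructor <;> linarith)
  have h2 : a + ε / 2 ∈ s := hball (by rw [Metric.mem_ball, Real.dist_eq, abs_lt]; constructor <;> linarith)
  refine hm.continuousAt_of_exists_between (hs.mem_nhds ha) (fun b hb => ?_) fun b hb => ?_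
  · have hlt : deriv g (a - ε / 2) < deriv g a := hm h1 ha (by linarith)
    obtain ⟨c, hcs, hcv⟩ := himg.out (mem_image_of_mem _ h1) (mem_image_of_mem _ ha)
      ⟨le_max_right b (deriv g (a - ε / 2)), (max_lt hb hlt).le⟩
    exact ⟨c, hcs, by rw [hcv]; exact ⟨le_max_left _ _, max_lt hb hlt⟩⟩
  · have hlt : deriv g a < deriv g (a + ε / 2) := hm ha h2 (by linarith)
    obtain ⟨c, hcs, hcv⟩ := himg.out (mem_image_of_mem _ ha) (mem_image_of_mem _ h2)
      ⟨(lt_min hb hlt).le, min_le_right b (deriv g (a + ε / 2))⟩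
    exact ⟨c, hcs, by rw [hcv]; exact ⟨lt_min hb hlt, min_le_left _ _⟩⟩

theorem RestrictedCost.strictMonoOn {e : E} (h : N.RestrictedCost e) :
    StrictMonoOn (deriv (N.cost e)) (Ioi 0) :=
  (h.1.subset Ioi_subset_Ici_self (convex_Ioi 0)).strictMonoOn_deriv fun x hx => h.2.2.1 x hx

/-- The mean value theorem turns the slope `-∞` at `0` into one point with a small derivative;
monotonicity carries the bound down to `0`. -/
theorem RestrictedCost.exists_deriv_lt {e : E} (h : N.RestrictedCost e) (M : ℝ) :
    ∃ β : ℝ, 0 < β ∧ ∀ α, 0 < α → α ≤ β → deriv (N.cost e) α < M := by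
  have h1 := h.2.2.2.eventually (eventually_lt_atBot M)
  obtain ⟨b, hb, hb0⟩ := (h1.and self_mem_nhdsWithin).exists
  have hb0 : 0 < b := hb0
  obtain ⟨c, hc, hcv⟩ := exists_deriv_eq_slope (N.cost e) hb0 (h.2.1.mono Icc_subset_Ici_self)
    fun x hx => (h.2.2.1 x hx.1).differentiableWithinAt
  refine ⟨c, hc.1, fun α h0 hα => ?_⟩
  refine (h.strictMonoOn.monotoneOn h0 hc.1 hα).trans_lt ?_
  rwa [hcv, sub_zero]

theorem FreeCost.strictMono {e : E} (h : N.FreeCost e) (hr : e ∉ N.restricted)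
    (hl : ¬ N.IsLinear e) : StrictMono (deriv (N.cost e)) := by
  have hs := h.2.2.resolve_left fun h' => hl ⟨hr, h'⟩
  exact strictMonoOn_univ.1 (hs.strictMonoOn_deriv fun x _ => h.2.1 x)

theorem dcost_of_not_restricted {e : E} (h : e ∉ N.restricted) (α : ℝ) :
    N.dcost e α = (deriv (N.cost e) α : ℝ) := by
  simp [dcost, h]

theorem dcost_of_pos (e : E) {α : ℝ} (h : 0 < α) : N.dcost e α = (deriv (N.cost e) α : ℝ) := by
  simp [dcost, not_le.2 h]

theorem dcost_of_nonpos {e : E} (h : e ∈ N.restricted) {α : ℝ} (hα : α ≤ 0) :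
    N.dcost e α = ⊥ := by
  simp [dcost, h, hα]

theorem dcost_ne_top (e : E) (α : ℝ) : N.dcost e α ≠ ⊤ := by
  unfold dcost; split_ifs <;> simp

theorem IsLinear.dcost_eq {e : E} (h : N.IsLinear e) (α β : ℝ) : N.dcost e α = N.dcost e β := by
  obtain ⟨hr, a, c, hac⟩ := h
  have : N.cost e = fun α => a * α + c := funext hac
  rw [dcost_of_not_restricted hr, dcost_of_not_restricted hr, this]
  simp

theorem IsLinear.dcost_coe {e : E} (h : N.IsLinear e) : ∃ a : ℝ, ∀ α, N.dcost e α = (a : EReal) :=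
  ⟨deriv (N.cost e) 0, fun α => by rw [h.dcost_eq α 0, dcost_of_not_restricted h.1]⟩

theorem Standing.dcost_lt (hN : N.Standing) {e : E} (hl : ¬ N.IsLinear e) {α β : ℝ} (h : α < β)
    (hα : N.dcost e α ≠ ⊥) : N.dcost e α < N.dcost e β := by
  by_cases hr : e ∈ N.restricted
  · have h0 : 0 < α := by
      by_contra h0; exact hα (dcost_of_nonpos hr (not_lt.1 h0))
    rw [dcost_of_pos e h0, dcost_of_pos e (h0.trans h), EReal.coe_lt_coe_iff]
    exact (hN.restr e hr).strictMonoOn h0 (h0.trans h) h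
  · rw [dcost_of_not_restricted hr, dcost_of_not_restricted hr, EReal.coe_lt_coe_iff]
    exact (hN.free e hr).strictMono hr hl h

theorem Standing.dcost_mono (hN : N.Standing) (e : E) : Monotone (N.dcost e) := by
  intro α β h
  by_cases hl : N.IsLinear e
  · exact (hl.dcost_eq α β).le
  · rcases h.eq_or_lt with rfl | h
    · exact le_rfl
    · by_cases hα : N.dcost e α = ⊥
      · simp [hα]
      · exact (hN.dcost_lt hl h hα).le

/-- On a restricted arc the derivative tends to `-∞` at `0`, so the value `⊥` on `(-∞, 0]` is a
continuous extension. Continuity serves limits of potentials and the equation `C'(y) = c`. -/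
theorem Standing.dcost_continuous (hN : N.Standing) (e : E) : Continuous (N.dcost e) := by
  by_cases hl : N.IsLinear e
  · obtain ⟨a, ha⟩ := hl.dcost_coe
    rw [show N.dcost e = fun _ => (a : EReal) from funext ha]
    exact continuous_const
  by_cases hr : e ∈ N.restricted
  · have hR := hN.restr e hr
    rw [continuous_iff_continuousAt]
    intro a
    rcases lt_or_ge 0 a with ha | ha
    · have hcont : ContinuousAt (fun x => ((deriv (N.cost e) x : ℝ) : EReal)) a :=
        continuous_coe_real_ereal.continuousAt.comp (continuousAt_deriv_of_strictMonoOn isOpen_Ioi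
          ordConnected_Ioi hR.2.2.1 hR.strictMonoOn ha)
      refine hcont.congr ?_
      filter_upwards [Ioi_mem_nhds ha] with x hx
      rw [dcost_of_pos e hx]
    · rw [ContinuousAt, dcost_of_nonpos hr ha, EReal.tendsto_nhds_bot_iff_real]
      intro M
      obtain ⟨β, hβ, h⟩ := hR.exists_deriv_lt M
      filter_upwards [Iio_mem_nhds (ha.trans_lt hβ)] with x hx
      rcases lt_or_ge 0 x with h0 | h0
      · rw [dcost_of_pos e h0, EReal.coe_lt_coe_iff]
        exact h x h0 (le_of_lt hx)
      · rw [dcost_of_nonpos hr h0]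
        exact EReal.bot_lt_coe M
  · rw [show N.dcost e = fun x => ((deriv (N.cost e) x : ℝ) : EReal) from
      funext (dcost_of_not_restricted hr), continuous_iff_continuousAt]
    intro a
    exact continuous_coe_real_ereal.continuousAt.comp (continuousAt_deriv_of_strictMonoOn isOpen_univ
      ordConnected_univ (fun x _ => (hN.free e hr).2.1 x)
      (strictMonoOn_univ.2 ((hN.free e hr).strictMono hr hl)) (mem_univ a))

/-! ### Walks -/

@[simp] theorem dsrc_true (e : E) : N.dsrc (e, true) = N.src e := rfl
@[simp] theorem dsrc_false (e : E) : N.dsrc (e, false) = N.tgt e := rfl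
@[simp] theorem dtgt_true (e : E) : N.dtgt (e, true) = N.tgt e := rfl
@[simp] theorem dtgt_false (e : E) : N.dtgt (e, false) = N.src e := rfl

theorem isWalk_append {i j : V} {p q : List (E × Bool)} :
    N.IsWalk i (p ++ q) j ↔ ∃ k, N.IsWalk i p k ∧ N.IsWalk k q j := by
  induction p generalizing i with
  | nil => simp [IsWalk]
  | cons d p ih => simp [IsWalk, ih, and_assoc]

theorem isWalk_singleton {i j : V} {d : E × Bool} :
    N.IsWalk i [d] j ↔ N.dsrc d = i ∧ N.dtgt d = j := by
  simp [IsWalk]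

/-- The opposite direction of an arc. -/
def flip (d : E × Bool) : E × Bool := (d.1, !d.2)

@[simp] theorem dsrc_flip (d : E × Bool) : N.dsrc (flip d) = N.dtgt d := by
  rcases d with ⟨e, _ | _⟩ <;> rfl

@[simp] theorem dtgt_flip (d : E × Bool) : N.dtgt (flip d) = N.dsrc d := by
  rcases d with ⟨e, _ | _⟩ <;> rfl

theorem IsWalk.reverse {i j : V} {p : List (E × Bool)} (h : N.IsWalk i p j) :
    N.IsWalk j (p.reverse.map flip) i := by
  induction p generalizing i with
  | nil => exact Eq.symm h
  | cons d p ih =>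
    rw [List.reverse_cons, List.map_append, isWalk_append]
    exact ⟨_, ih h.2, by simp [IsWalk, h.1]⟩

theorem IsPath.cons_iff {i j : V} {d : E × Bool} {p : List (E × Bool)} :
    N.IsPath i (d :: p) j ↔
      N.dsrc d = i ∧ N.IsPath (N.dtgt d) p j ∧ i ≠ N.dtgt d ∧ i ∉ p.map N.dtgt := by
  simp only [IsPath, IsWalk, List.map_cons, List.nodup_cons, List.mem_cons, not_or]
  tauto

theorem IsPath.suffix {i j k : V} {p : List (E × Bool)} (h : N.IsPath i p j)
    (hk : k = i ∨ k ∈ p.map N.dtgt) : ∃ q, N.IsPath k q j ∧ q.Sublist p := by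
  induction p generalizing i with
  | nil =>
    obtain rfl : k = i := by simpa using hk
    exact ⟨[], h, List.Sublist.refl _⟩
  | cons d p ih =>
    rcases hk with rfl | hk
    · exact ⟨_, h, List.Sublist.refl _⟩
    · obtain ⟨q, hq, hs⟩ := ih (IsPath.cons_iff.1 h).2.1 (by simpa using hk)
      exact ⟨q, hq, hs.cons _⟩

theorem IsWalk.exists_path {i j : V} {p : List (E × Bool)} (h : N.IsWalk i p j) :
    ∃ q, N.IsPath i q j ∧ q.Sublist p := by
  induction p generalizing i with
  | nil => exact ⟨[], ⟨h, by simp⟩, List.Sublist.refl _⟩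
  | cons d p ih =>
    obtain ⟨q, hq, hs⟩ := ih h.2
    by_cases hi : i = N.dtgt d ∨ i ∈ q.map N.dtgt
    · obtain ⟨q', hq', hs'⟩ := hq.suffix hi
      exact ⟨q', hq', (hs'.trans hs).cons _⟩
    · rw [not_or] at hi
      exact ⟨d :: q, IsPath.cons_iff.2 ⟨h.1, hq, hi⟩, hs.cons_cons _⟩

theorem exists_walk_of_reflTransGen {R : Set (E × Bool)} {i j : V}
    (h : Relation.ReflTransGen (fun a b => ∃ d ∈ R, N.dsrc d = a ∧ N.dtgt d = b) i j) :
    ∃ p, N.IsWalk i p j ∧ ∀ d ∈ p, d ∈ R := by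
  induction h with
  | refl => exact ⟨[], rfl, by simp⟩
  | tail _ hd ih =>
    obtain ⟨p, hp, hR⟩ := ih
    obtain ⟨d, hdR, rfl, rfl⟩ := hd
    refine ⟨p ++ [d], isWalk_append.2 ⟨_, hp, isWalk_singleton.2 ⟨rfl, rfl⟩⟩, ?_⟩
    simp only [List.mem_append, List.mem_singleton]
    rintro d' (h | rfl)
    exacts [hR _ h, hdR]

theorem Standing.exists_walk (hN : N.Standing) (i j : V) :
    ∃ p, N.IsWalk i p j ∧ ∀ d ∈ p, d.2 = true := by
  refine exists_walk_of_reflTransGen (R := {d | d.2 = true}) ?_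
  refine (hN.stronglyConnected i j).lift id ?_
  rintro a b ⟨e, ha, hb⟩
  exact ⟨(e, true), rfl, ha, hb⟩

/-- Using an arc twice in one direction repeats its head; using it in both directions returns to its
tail. Thus a push along a path changes each arc at most once. -/
theorem IsPath.nodup_arcs {i j : V} {p : List (E × Bool)} (h : N.IsPath i p j) :
    (p.map Prod.fst).Nodup := by
  induction p generalizing i with
  | nil => simp
  | cons d p ih =>
    have h' := IsPath.cons_iff.1 h
    rw [List.map_cons, List.nodup_cons]
    refine ⟨fun hd => ?_, ih h'.2.1⟩
    obtain ⟨d', hd', he⟩ := List.mem_map.1 hd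
    by_cases hb : d'.2 = d.2
    · have : d' = d := Prod.ext he hb
      subst this
      exact (List.nodup_cons.1 h'.2.1.2).1 (List.mem_map_of_mem hd')
    · refine h'.2.2.2 (List.mem_map.2 ⟨d', hd', ?_⟩)
      have : d' = flip d := Prod.ext he (by cases h1 : d'.2 <;> cases h2 : d.2 <;> simp_all [flip])
      rw [this, dtgt_flip, h'.1]

/-! ### Linear acyclic sets. -/

theorem LinearAcyclic.mono {F G : Set E} (h : N.LinearAcyclic G) (hFG : F ⊆ G) :
    N.LinearAcyclic F :=
  fun ⟨p, hp, hl⟩ => h ⟨p, hp, fun d hd => ⟨hFG (hl d hd).1, (hl d hd).2⟩⟩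

theorem linearAcyclic_empty : N.LinearAcyclic (∅ : Set E) := by
  rintro ⟨p, hp, hl⟩
  obtain ⟨d, hd⟩ := List.exists_mem_of_ne_nil p hp.1
  exact (hl d hd).1

/-- An arc that closes a cycle of linear arcs is linear, and its ends are joined by a path of linear
arcs. -/
theorem LinearAcyclic.exists_path {F : Set E} (h : N.LinearAcyclic F) {e : E}
    (he : ¬ N.LinearAcyclic (insert e F)) :
    N.IsLinear e ∧ ∃ p, N.IsPath (N.src e) p (N.tgt e) ∧ ∀ d ∈ p, d.1 ∈ F ∧ N.IsLinear d.1 := by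
  obtain ⟨p, hp, hl⟩ := not_not.1 he
  obtain ⟨d, hd, rfl⟩ : ∃ d ∈ p, d.1 = e := by
    by_contra hne
    push Not at hne
    exact h ⟨p, hp, fun d hd => ⟨((hl d hd).1.resolve_left (hne d hd)), (hl d hd).2⟩⟩
  refine ⟨(hl d hd).2, ?_⟩
  obtain ⟨a, c, rfl⟩ := List.append_of_mem hd
  obtain ⟨-, ⟨i, hw⟩, -, hnd⟩ := hp
  obtain ⟨k, hwa, hdk, hwc⟩ := isWalk_append.1 hw
  -- Rotating the cycle and removing `d` leaves a walk from the head of `d` back to its tail; it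
  -- must be reversed when `d` is a forward arc.
  have hw' : N.IsWalk (N.dtgt d) (c ++ a) (N.dsrc d) :=
    isWalk_append.2 ⟨i, hwc, by rw [hdk]; exact hwa⟩
  have hF : ∀ d' ∈ c ++ a, d'.1 ∈ F ∧ N.IsLinear d'.1 := by
    intro d' hd'
    have hmem : d' ∈ a ++ d :: c := by
      simp only [List.mem_append, List.mem_cons] at hd' ⊢; tauto
    refine ⟨(hl d' hmem).1.resolve_left fun heq => ?_, (hl d' hmem).2⟩
    rw [List.map_append, List.map_cons, List.nodup_middle, List.nodup_cons] at hnd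
    refine hnd.1 ?_
    rw [← heq, ← List.map_append]
    refine List.mem_map_of_mem ?_
    simp only [List.mem_append] at hd' ⊢; tauto
  have hsub : ∀ {i j : V} {w : List (E × Bool)}, N.IsWalk i w j →
      (∀ d' ∈ w, d'.1 ∈ F ∧ N.IsLinear d'.1) →
      ∃ q, N.IsPath i q j ∧ ∀ d' ∈ q, d'.1 ∈ F ∧ N.IsLinear d'.1 := by
    intro i j w hw hwF
    obtain ⟨q, hq, hs⟩ := hw.exists_path
    exact ⟨q, hq, fun d' hd' => hwF d' (hs.subset hd')⟩
  obtain ⟨e, b⟩ := d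
  cases b
  · exact hsub hw' hF
  · refine hsub hw'.reverse fun d' hd' => ?_
    obtain ⟨d'', hd'', rfl⟩ := List.mem_map.1 hd'
    exact hF d'' (List.mem_reverse.1 hd'')

theorem finite_paths (i j : V) : {p : List (E × Bool) | N.IsPath i p j}.Finite := by
  refine (List.finite_length_le (E × Bool) (Fintype.card V)).subset fun p hp => ?_
  have := hp.2.length_le_card
  simp only [List.length_cons, List.length_map] at this
  exact (Nat.le_succ _).trans this

/-! ### Flows -/

/-- Summation by parts. Indicators for `σ` give the cut formulas, signs give `sum_abs_netInflow_le`.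
-/
theorem sum_mul_netInflow (σ : V → ℝ) (z : E → ℝ) :
    ∑ i, σ i * N.netInflow z i = ∑ e, z e * (σ (N.tgt e) - σ (N.src e)) := by
  classical
  have key : ∀ g : E → V, ∑ i, σ i * ∑ e with g e = i, z e = ∑ e, z e * σ (g e) := by
    intro g
    simp_rw [Finset.mul_sum, Finset.sum_filter]
    rw [Finset.sum_comm]
    refine Finset.sum_congr rfl fun e _ => ?_
    simp [mul_comm]
  simp only [netInflow, mul_sub, Finset.sum_sub_distrib]
  rw [← key, ← key]

theorem netInflow_sub (f g : E → ℝ) (i : V) :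
    N.netInflow (fun e => f e - g e) i = N.netInflow f i - N.netInflow g i := by
  simp only [netInflow, Finset.sum_sub_distrib]; ring

theorem netInflow_add (f g : E → ℝ) (i : V) :
    N.netInflow (fun e => f e + g e) i = N.netInflow f i + N.netInflow g i := by
  simp only [netInflow, Finset.sum_add_distrib]; ring

theorem netInflow_smul (c : ℝ) (f : E → ℝ) (i : V) :
    N.netInflow (fun e => c * f e) i = c * N.netInflow f i := by
  simp only [netInflow, ← Finset.mul_sum]; ring

theorem netInflow_zero (i : V) : N.netInflow 0 i = 0 := by
  simp [netInflow]

theorem sum_netInflow (f : E → ℝ) : ∑ i, N.netInflow f i = 0 := by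
  simpa using N.sum_mul_netInflow (fun _ => 1) f

open scoped Classical in
/-- The unit mass at `i`. -/
def unitMass (i k : V) : ℝ := if k = i then 1 else 0

@[simp] theorem unitMass_self (i : V) : unitMass i i = 1 := by simp [unitMass]

theorem unitMass_of_ne {i k : V} (h : k ≠ i) : unitMass i k = 0 := by simp [unitMass, h]

open scoped Classical in
theorem netInflow_single (e : E) (a : ℝ) (i : V) :
    N.netInflow (fun e' => if e = e' then a else 0) i =
      a * (unitMass (N.tgt e) i - unitMass (N.src e) i) := by
  have := N.sum_mul_netInflow (fun k => if k = i then 1 else 0) (fun e' => if e = e' then a else 0)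
  simp only [ite_mul, one_mul, zero_mul, Finset.sum_ite_eq', Finset.sum_ite_eq, Finset.mem_univ,
    if_true] at this
  rw [this]
  simp only [unitMass, eq_comm]

open scoped Classical in
-- Take for `σ` the signs of the imbalances: it varies by at most `2` along an arc.
theorem sum_abs_netInflow_le (z : E → ℝ) :
    ∑ i, |N.netInflow z i| ≤ 2 * ∑ e, |z e| := by
  have h1 : ∀ i, |N.netInflow z i| =
      (if 0 ≤ N.netInflow z i then 1 else -1) * N.netInflow z i := by
    intro i
    split_ifs with h
    · rw [abs_of_nonneg h, one_mul]
    · rw [abs_of_neg (not_le.1 h)]; ring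
  simp_rw [h1]
  rw [sum_mul_netInflow, Finset.mul_sum]
  refine Finset.sum_le_sum fun e _ => ?_
  have := neg_abs_le (z e)
  have := le_abs_self (z e)
  split_ifs <;> nlinarith

open scoped Classical in
theorem push_cons (f : E → ℝ) (d : E × Bool) (p : List (E × Bool)) (δ : ℝ) :
    push f (d :: p) δ =
      fun e => push f p δ e + if d.1 = e then (if d.2 then δ else -δ) else 0 := by
  funext e
  simp only [push, List.map_cons, List.sum_cons]
  ring

theorem push_of_notMem {f : E → ℝ} {p : List (E × Bool)} {δ : ℝ} {e : E}
    (h : ∀ d ∈ p, d.1 ≠ e) : push f p δ e = f e := by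
  induction p with
  | nil => simp [push]
  | cons d p ih =>
    rw [push_cons]
    simp only [h d (by simp), if_false, add_zero]
    exact ih fun d' hd' => h d' (by simp [hd'])

theorem push_of_mem {f : E → ℝ} {p : List (E × Bool)} {δ : ℝ} {d : E × Bool}
    (hp : (p.map Prod.fst).Nodup) (hd : d ∈ p) :
    push f p δ d.1 = f d.1 + if d.2 then δ else -δ := by
  induction p with
  | nil => simp at hd
  | cons d' p ih =>
    rw [List.map_cons, List.nodup_cons] at hp
    rw [push_cons]
    rcases List.mem_cons.1 hd with rfl | hd
    · have : push f p δ d.1 = f d.1 := push_of_notMem fun d' hd' heq =>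
        hp.1 (heq ▸ List.mem_map_of_mem hd')
      simp [this]
    · have : d'.1 ≠ d.1 := fun heq => hp.1 (heq ▸ List.mem_map_of_mem hd)
      simp [this, ih hp.2 hd]

theorem netInflow_push {i j : V} {p : List (E × Bool)} (h : N.IsWalk i p j) (f : E → ℝ) (δ : ℝ)
    (k : V) : N.netInflow (push f p δ) k =
      N.netInflow f k + δ * (unitMass j k - unitMass i k) := by
  induction p generalizing i with
  | nil =>
    obtain rfl : i = j := h
    have : push f [] δ = f := by funext e; simp [push]
    simp [this]
  | cons d p ih =>
    rw [push_cons, netInflow_add, netInflow_single, ih h.2]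
    obtain ⟨e, b⟩ := d
    obtain ⟨rfl, -⟩ := h
    cases b
    · simp only [dtgt_false, dsrc_false, Bool.false_eq_true, if_false]; ring
    · simp only [dtgt_true, dsrc_true, if_true]; ring

/-! ### Cuts -/

open scoped Classical in
theorem sum_netInflow_cut (U : Set V) (z : E → ℝ) :
    ∑ i with i ∈ U, N.netInflow z i =
      ∑ e, z e * ((if N.tgt e ∈ U then 1 else 0) - if N.src e ∈ U then 1 else 0) := by
  rw [← sum_mul_netInflow (fun i => if i ∈ U then (1 : ℝ) else 0) z, Finset.sum_filter]
  refine Finset.sum_congr rfl fun i _ => ?_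
  split_ifs <;> simp

open scoped Classical in
theorem sum_filter_le_sum_abs (U : Set V) (r : V → ℝ) : ∑ i with i ∈ U, r i ≤ ∑ i, |r i| :=
  (Finset.sum_le_sum fun i _ => le_abs_self (r i)).trans
    (Finset.sum_le_sum_of_subset_of_nonneg (Finset.filter_subset _ _) fun _ _ _ => abs_nonneg _)

/-- The arcs that carry flow, in the direction of the flow. -/
def carrying (z : E → ℝ) : Set (E × Bool) := {d | if d.2 then 0 < z d.1 else z d.1 < 0}

theorem carrying_unique {z : E → ℝ} {d d' : E × Bool} (hd : d ∈ carrying z) (hd' : d' ∈ carrying z)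
    (h : d.1 = d'.1) : d = d' := by
  rcases d with ⟨e, _ | _⟩ <;> rcases d' with ⟨e', _ | _⟩ <;> obtain rfl : e = e' := h <;>
    simp [carrying] at hd hd' ⊢ <;> linarith

/-- On a closed walk the bounds force `σ` to be constant, so no arc of it can increase `σ` strictly.
-/
theorem IsWalk.potential_le {R : Set (E × Bool)} {σ : V → ℝ}
    (hσ : ∀ d ∈ R, σ (N.dsrc d) ≤ σ (N.dtgt d)) {i j : V} {p : List (E × Bool)}
    (h : N.IsWalk i p j) (hp : ∀ d ∈ p, d ∈ R) :
    σ i ≤ σ j ∧ ∀ d ∈ p, σ i ≤ σ (N.dsrc d) ∧ σ (N.dtgt d) ≤ σ j := by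
  induction p generalizing i with
  | nil => obtain rfl : i = j := h; simp
  | cons d p ih =>
    obtain ⟨h1, h2⟩ := ih h.2 fun d' hd' => hp d' (by simp [hd'])
    have h3 := hσ d (hp d (by simp))
    obtain ⟨rfl, -⟩ := h
    refine ⟨h3.trans h1, fun d' hd' => ?_⟩
    rcases List.mem_cons.1 hd' with rfl | hd'
    · exact ⟨le_rfl, h1⟩
    · exact ⟨h3.trans (h2 d' hd').1, (h2 d' hd').2⟩

/-- If a potential increases along the flow, strictly on nonlinear arcs, and the flow is supported on
a linear acyclic set, then no arc carries more than the total imbalance. -/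
theorem LinearAcyclic.abs_le_sum_abs_netInflow {F : Set E} (hF : N.LinearAcyclic F) {z : E → ℝ}
    (σ : V → ℝ) (hz : ∀ e, e ∉ F → z e = 0)
    (hσ : ∀ d ∈ carrying z, σ (N.dsrc d) ≤ σ (N.dtgt d) ∧
      (¬ N.IsLinear d.1 → σ (N.dsrc d) < σ (N.dtgt d))) (e : E) :
    |z e| ≤ ∑ i, |N.netInflow z i| := by
  classical
  rcases eq_or_ne (z e) 0 with h0 | h0
  · rw [h0, abs_zero]
    exact Finset.sum_nonneg fun _ _ => abs_nonneg _
  obtain ⟨d, hd, rfl⟩ : ∃ d ∈ carrying z, d.1 = e := by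
    rcases lt_or_gt_of_ne h0 with h | h
    · exact ⟨(e, false), by simpa [carrying] using h, rfl⟩
    · exact ⟨(e, true), by simpa [carrying] using h, rfl⟩
  -- The nodes that the flow reaches from the head of `d`.
  set U : Set V := {v | Relation.ReflTransGen
    (fun a b => ∃ d ∈ carrying z, N.dsrc d = a ∧ N.dtgt d = b) (N.dtgt d) v} with hU
  have htgt : N.dtgt d ∈ U := Relation.ReflTransGen.refl
  have hsrc : N.dsrc d ∉ U := by
    intro h
    obtain ⟨p, hp, hpR⟩ := exists_walk_of_reflTransGen h
    obtain ⟨q, hq, hs⟩ := hp.exists_path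
    have hqR : ∀ d' ∈ d :: q, d' ∈ carrying z := by
      intro d' hd'
      rcases List.mem_cons.1 hd' with rfl | hd'
      exacts [hd, hpR _ (hs.subset hd')]
    have hw : N.IsWalk (N.dsrc d) (d :: q) (N.dsrc d) := ⟨rfl, hq.1⟩
    -- If the flow returned to the tail of `d`, it would close a cycle. There `σ` is constant, so
    -- all its arcs are linear, against acyclicity.
    refine hF ⟨d :: q, ⟨by simp, ⟨_, hw⟩, hq.2, ?_⟩, fun d' hd' => ⟨?_, ?_⟩⟩
    · exact List.Nodup.map_on (fun a ha b hb => carrying_unique (hqR a ha) (hqR b hb))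
        (List.Nodup.of_map N.dtgt hq.2)
    · by_contra hne
      have := hqR d' hd'
      simp [carrying, hz _ hne] at this
    · by_contra hl
      have h1 := (hw.potential_le (fun d h => (hσ d h).1) hqR).2 d' hd'
      have h2 := (hσ d' (hqR d' hd')).2 hl
      linarith
  have hclosed : ∀ d' ∈ carrying z, N.dsrc d' ∈ U → N.dtgt d' ∈ U :=
    fun d' hd' h => Relation.ReflTransGen.tail h ⟨d', hd', rfl, rfl⟩
  refine le_trans ?_ (sum_filter_le_sum_abs U (N.netInflow z))
  rw [sum_netInflow_cut]
  -- No flow leaves `U`, so every term of the cut is nonnegative; the arc of `d` alone contributes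
  -- `|z d.1|`.
  have hterm : ∀ e, 0 ≤ z e * ((if N.tgt e ∈ U then 1 else 0) - if N.src e ∈ U then 1 else 0) := by
    intro e
    rcases lt_trichotomy (z e) 0 with h | h | h
    · have := hclosed (e, false) (by simpa [carrying] using h)
      simp only [dsrc_false, dtgt_false] at this
      by_cases h1 : N.tgt e ∈ U
      · simp [h1, this h1]
      · by_cases h2 : N.src e ∈ U <;> simp [h1, h2, h.le]
    · simp [h]
    · have := hclosed (e, true) (by simpa [carrying] using h)
      simp only [dsrc_true, dtgt_true] at this
      by_cases h1 : N.src e ∈ U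
      · simp [h1, this h1]
      · by_cases h2 : N.tgt e ∈ U <;> simp [h1, h2, h.le]
  refine le_trans (le_of_eq ?_) (Finset.single_le_sum (fun e _ => hterm e) (Finset.mem_univ d.1))
  obtain ⟨e, _ | _⟩ := d
  · simp only [dsrc_false, dtgt_false] at htgt hsrc
    simp only [carrying, mem_ofPred_eq, Bool.false_eq_true, if_false] at hd
    simp [htgt, hsrc, abs_of_neg hd]
  · simp only [dsrc_true, dtgt_true] at htgt hsrc
    simp only [carrying, mem_ofPred_eq, if_true] at hd
    simp [htgt, hsrc, abs_of_pos hd]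

/-- The distance of two tight vectors is bounded by the distance of their imbalances. -/
theorem Standing.abs_sub_le_of_isTight (hN : N.Standing) {F : Set E} {x y : E → ℝ}
    (hF : N.LinearAcyclic F) (hx : N.IsTight F x) (hy : N.IsTight F y) (e : E) :
    |x e - y e| ≤ ∑ i, |N.netInflow x i - N.netInflow y i| := by
  obtain ⟨hx0, π, hπ⟩ := hx
  obtain ⟨hy0, π', hπ'⟩ := hy
  have key : ∀ {a b : E → ℝ} {α β : V → ℝ} {e : E},
      ((α (N.tgt e) - α (N.src e) : ℝ) : EReal) = N.dcost e (a e) →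
      ((β (N.tgt e) - β (N.src e) : ℝ) : EReal) = N.dcost e (b e) → a e < b e →
      α (N.tgt e) - α (N.src e) ≤ β (N.tgt e) - β (N.src e) ∧
      (¬ N.IsLinear e → α (N.tgt e) - α (N.src e) < β (N.tgt e) - β (N.src e)) := by
    intro a b α β e ha hb hlt
    rw [← EReal.coe_le_coe_iff, ← EReal.coe_lt_coe_iff, ha, hb]
    exact ⟨hN.dcost_mono e hlt.le, fun hl => hN.dcost_lt hl hlt (ha ▸ EReal.coe_ne_bot _)⟩
  -- More flow means a larger marginal cost, strictly on nonlinear arcs; hence `π - π'` increases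
  -- along the flow `x - y`.
  have := hF.abs_le_sum_abs_netInflow (z := fun e => x e - y e) (fun v => π v - π' v)
    (fun e he => by simp [hx0 e he, hy0 e he]) ?_ e
  · simpa only [netInflow_sub] using this
  · intro d hd
    have hdF : d.1 ∈ F := by
      by_contra hne
      simp [carrying, hx0 _ hne, hy0 _ hne] at hd
    obtain ⟨e, _ | _⟩ := d
    · simp only [carrying, mem_ofPred_eq, Bool.false_eq_true, if_false, sub_neg] at hd
      have := key (hπ e hdF) (hπ' e hdF) hd
      simp only [dsrc_false, dtgt_false]
      exact ⟨by linarith [this.1], fun hl => by linarith [this.2 hl]⟩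
    · simp only [carrying, mem_ofPred_eq, if_true, sub_pos] at hd
      have := key (hπ' e hdF) (hπ e hdF) hd
      simp only [dsrc_true, dtgt_true]
      exact ⟨by linarith [this.1], fun hl => by linarith [this.2 hl]⟩

/-! ### Size of linear acyclic sets -/

/-- The imbalance as a linear map. -/
def netInflowLinear (N : FlowNetwork V E) : (E → ℝ) →ₗ[ℝ] (V → ℝ) where
  toFun := N.netInflow
  map_add' f g := funext fun i => netInflow_add f g i
  map_smul' c f := funext fun i => netInflow_smul c f i

/-- A dimension count: the imbalance map is injective on vectors supported on the forest, and its
image avoids the nonzero constant vectors because imbalances sum to zero. -/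
theorem LinearAcyclic.ncard_linear_lt [Nonempty V] {F : Set E} (hF : N.LinearAcyclic F) :
    {e ∈ F | N.IsLinear e}.ncard + 1 ≤ Fintype.card V := by
  classical
  set G : Set E := {e ∈ F | N.IsLinear e}
  let ext : (G → ℝ) →ₗ[ℝ] (E → ℝ) := Function.ExtendByZero.linearMap ℝ Subtype.val
  let φ : (G → ℝ) × ℝ →ₗ[ℝ] (V → ℝ) :=
    (N.netInflowLinear ∘ₗ ext).coprod (LinearMap.toSpanSingleton ℝ (V → ℝ) 1)
  have hφ : Function.Injective φ := by
    rw [injective_iff_map_eq_zero]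
    rintro ⟨x, c⟩ h
    have h1 : ∀ i, N.netInflow (ext x) i + c = 0 := by
      intro i
      simpa [φ, netInflowLinear] using congrFun h i
    have hc : c = 0 := by
      have h2 : ∑ i, (N.netInflow (ext x) i + c) = 0 := Finset.sum_eq_zero fun i _ => h1 i
      rw [Finset.sum_add_distrib, sum_netInflow, zero_add, Finset.sum_const, nsmul_eq_mul,
        mul_eq_zero] at h2
      exact h2.resolve_left (Nat.cast_ne_zero.2 Fintype.card_ne_zero)
    have hG : N.LinearAcyclic G := hF.mono fun e he => he.1
    have h0 : ∀ e, e ∉ G → ext x e = 0 := fun e he =>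
      Function.extend_apply' _ _ _ fun ⟨a, ha⟩ => he (ha ▸ a.2)
    refine Prod.ext (funext fun e => ?_) hc
    -- With linear arcs only, the potential `0` is admissible, so zero imbalance forces zero flow.
    have h3 := hG.abs_le_sum_abs_netInflow (z := ext x) 0 h0 (fun d hd => ⟨le_rfl, fun hl => ?_⟩) e
    · rw [Finset.sum_eq_zero fun i _ => by
        rw [abs_eq_zero]; linarith [h1 i], abs_nonpos_iff] at h3
      exact (Subtype.val_injective.extend_apply x 0 e).symm.trans h3
    · refine absurd ?_ hl
      by_contra hne
      simp [carrying, h0 _ fun h => hne h.2] at hd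
  have := LinearMap.finrank_le_finrank_of_injective hφ
  rw [Module.finrank_prod, Module.finrank_pi, Module.finrank_pi, Module.finrank_self] at this
  rwa [← Nat.card_coe_set_eq, Nat.card_eq_fintype_card]

theorem LinearAcyclic.ncard_lt [Nonempty V] {F : Set E} (hF : N.LinearAcyclic F) :
    F.ncard + 1 ≤ Fintype.card V + N.numNonlinear := by
  have h1 : F ⊆ {e ∈ F | N.IsLinear e} ∪ {e | ¬ N.IsLinear e} := by
    intro e he
    by_cases h : N.IsLinear e
    exacts [Or.inl ⟨he, h⟩, Or.inr h]
  have h2 := (Set.ncard_le_ncard h1 (Set.toFinite _)).trans (Set.ncard_union_le _ _)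
  have h3 := hF.ncard_linear_lt
  unfold numNonlinear
  omega

/-! ### Arcs of large flow are tight -/

theorem excess_nonneg (b : V → ℝ) (f : E → ℝ) : 0 ≤ N.excess b f :=
  Finset.sum_nonneg fun _ _ => le_max_right _ _

open scoped Classical in
theorem sum_filter_le_excess (U : Set V) (b : V → ℝ) (f : E → ℝ) :
    ∑ i with i ∈ U, (N.netInflow f i - b i) ≤ N.excess b f :=
  (Finset.sum_le_sum fun i _ => le_max_left (N.netInflow f i - b i) 0).trans
    (Finset.sum_le_sum_of_subset_of_nonneg (Finset.filter_subset _ _) fun _ _ _ => le_max_right _ _)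

/-! ### Feasibility and optimality as inequalities on the original arcs. -/

theorem FeasiblePotential.forward {F : Set E} {f : E → ℝ} {Δ : ℝ} {π : V → ℝ}
    (h : N.FeasiblePotential F f Δ π) (e : E) :
    ((π (N.tgt e) - π (N.src e) : ℝ) : EReal) ≤ N.dcost e (f e + Δ) :=
  h (e, true) (Or.inl rfl)

theorem FeasiblePotential.backward {F : Set E} {f : E → ℝ} {Δ : ℝ} {π : V → ℝ}
    (h : N.FeasiblePotential F f Δ π) {e : E} (he : e ∈ F ∨ Δ ≤ f e) :
    N.dcost e (f e - Δ) ≤ ((π (N.tgt e) - π (N.src e) : ℝ) : EReal) := by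
  have := h (e, false) (Or.inr he)
  simp only [dartCost, dtgt_false, dsrc_false, Bool.false_eq_true, if_false] at this
  rw [← EReal.neg_le_neg_iff, ← EReal.coe_neg, neg_sub]
  exact this

theorem feasiblePotential_iff {F : Set E} {f : E → ℝ} {Δ : ℝ} {π : V → ℝ} :
    N.FeasiblePotential F f Δ π ↔
      (∀ e, ((π (N.tgt e) - π (N.src e) : ℝ) : EReal) ≤ N.dcost e (f e + Δ)) ∧
      ∀ e, e ∈ F ∨ Δ ≤ f e →
        N.dcost e (f e - Δ) ≤ ((π (N.tgt e) - π (N.src e) : ℝ) : EReal) := by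
  refine ⟨fun h => ⟨h.forward, fun e => h.backward⟩, fun ⟨h1, h2⟩ d hd => ?_⟩
  obtain ⟨e, _ | _⟩ := d
  · have := h2 e (by simpa [residualAt] using hd)
    simp only [dartCost, dtgt_false, dsrc_false, Bool.false_eq_true, if_false]
    rw [← EReal.neg_le_neg_iff, ← EReal.coe_neg, neg_sub, neg_neg]
    exact this
  · exact h1 e

theorem optPotential_iff {F : Set E} {f : E → ℝ} {π : V → ℝ} :
    N.OptPotential F f π ↔
      (∀ e, ((π (N.tgt e) - π (N.src e) : ℝ) : EReal) ≤ N.dcost e (f e)) ∧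
      ∀ e, e ∈ F ∨ 0 < f e → N.dcost e (f e) ≤ ((π (N.tgt e) - π (N.src e) : ℝ) : EReal) := by
  constructor
  · intro h
    refine ⟨fun e => by simpa [dartCost] using h (e, true) (Or.inl rfl), fun e he => ?_⟩
    have := h (e, false) (Or.inr he)
    simp only [dartCost, dtgt_false, dsrc_false, Bool.false_eq_true, if_false, sub_zero] at this
    rw [← EReal.neg_le_neg_iff, ← EReal.coe_neg, neg_sub]
    exact this
  · rintro ⟨h1, h2⟩ ⟨e, _ | _⟩ hd
    · have := h2 e (by simpa [residual] using hd)
      simp only [dartCost, dtgt_false, dsrc_false, Bool.false_eq_true, if_false, sub_zero]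
      rw [← EReal.neg_le_neg_iff, ← EReal.coe_neg, neg_sub, neg_neg]
      exact this
    · simpa [dartCost] using h1 e

/-- In a `(Δ, F)`-feasible vector with `F` a set of tight arcs, an arc whose flow exceeds `Ex + mΔ` is
tight. -/
theorem Standing.mem_tightArcs (hN : N.Standing) {F : Set E} {f : E → ℝ} {Δ : ℝ} {π : V → ℝ}
    (hΔ : 0 < Δ) (hf : N.IsPseudoflow F f) (hπ : N.FeasiblePotential F f Δ π)
    (hF : F ⊆ N.tightArcs) {e : E}
    (he : N.excess N.demand f + Fintype.card E * Δ < f e) : e ∈ N.tightArcs := by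
  classical
  rintro f₀ π₀ ⟨hf₀, hb, hopt⟩
  by_contra hne
  have hopt' := optPotential_iff.1 hopt
  have hlt : ((π₀ (N.tgt e) - π₀ (N.src e) : ℝ) : EReal) < N.dcost e (f₀ e) :=
    lt_of_le_of_ne (hopt'.1 e) hne
  have h0 : f₀ e = 0 := by
    by_contra h
    exact absurd (hopt'.2 e (Or.inr (lt_of_le_of_ne (hf₀ e) (Ne.symm h)))) (not_le.2 hlt)
  set z : E → ℝ := fun e => f e - f₀ e with hz
  set σ : V → ℝ := fun v => π v - π₀ v with hσ
  have hcard : (1 : ℝ) ≤ Fintype.card E := by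
    have := hN.two_le
    exact_mod_cast (by omega : 1 ≤ Fintype.card E)
  have hex := N.excess_nonneg N.demand f
  have hup : ∀ a, Δ < z a → σ (N.src a) ≤ σ (N.tgt a) := by
    intro a ha
    have h1 := hπ.backward (e := a) (Or.inr (by linarith [hf₀ a]))
    have h2 := (hopt'.1 a).trans
      ((hN.dcost_mono a (by linarith : f₀ a ≤ f a - Δ)).trans h1)
    rw [EReal.coe_le_coe_iff] at h2
    simp only [hσ]; linarith
  -- Equality at the optimal pair needs `f₀ a > 0` or a tight arc. Off `F` the former follows from
  -- `f a ≥ 0`; on `F`, where `f a` may be negative, `F ⊆ F*` is used.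
  have hdown : ∀ a, z a < -Δ → σ (N.tgt a) ≤ σ (N.src a) := by
    intro a ha
    have h1 : N.dcost a (f₀ a) ≤ ((π₀ (N.tgt a) - π₀ (N.src a) : ℝ) : EReal) := by
      by_cases haF : a ∈ F
      · exact (hF haF f₀ π₀ ⟨hf₀, hb, hopt⟩).ge
      · exact hopt'.2 a (Or.inr (by linarith [hf a haF]))
    have h2 := (hπ.forward a).trans
      ((hN.dcost_mono a (by linarith : f a + Δ ≤ f₀ a)).trans h1)
    rw [EReal.coe_le_coe_iff] at h2
    simp only [hσ]; linarith
  have hstrict : σ (N.src e) < σ (N.tgt e) := by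
    have h1 := hπ.backward (e := e) (Or.inr (by nlinarith))
    have h2 := hlt.trans_le
      ((hN.dcost_mono e (by nlinarith : f₀ e ≤ f e - Δ)).trans h1)
    rw [EReal.coe_lt_coe_iff] at h2
    simp only [hσ]; linarith
  -- By `hup` and `hdown`, this level set is crossed in the unfavourable direction by at most `Δ`
  -- per arc, whereas `e` enters it.
  set U : Set V := {v | σ (N.tgt e) ≤ σ v} with hU
  have hcut := sum_netInflow_cut (N := N) U z
  have hle : ∑ i with i ∈ U, N.netInflow z i ≤ N.excess N.demand f := by
    refine le_trans (le_of_eq (Finset.sum_congr rfl fun i _ => ?_))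
      (sum_filter_le_excess U N.demand f)
    rw [hz, netInflow_sub, hb]
  have hterm : ∀ a, -Δ ≤
      z a * ((if N.tgt a ∈ U then 1 else 0) - if N.src a ∈ U then 1 else 0) := by
    intro a
    by_cases h1 : N.tgt a ∈ U <;> by_cases h2 : N.src a ∈ U
    · simp [h1, h2, hΔ.le]
    · simp only [h1, h2, if_true, if_false]
      by_contra hlt
      exact h2 (le_trans h1 (hdown a (by linarith)))
    · simp only [h1, h2, if_true, if_false]
      by_contra hlt
      exact h1 (le_trans h2 (hup a (by linarith)))
    · simp [h1, h2, hΔ.le]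
  have hte : f e = z e * ((if N.tgt e ∈ U then 1 else 0) - if N.src e ∈ U then 1 else 0) := by
    have h1 : N.tgt e ∈ U := le_refl (σ (N.tgt e))
    have h2 : N.src e ∉ U := not_le.2 hstrict
    simp [h1, h2, hz, h0]
  -- The other `m - 1` arcs lose at most `Δ` each, so `f e ≤ Ex + (m - 1) Δ`, a contradiction.
  have hsum : f e + ∑ a ∈ Finset.univ.erase e, -Δ ≤
      ∑ a, z a * ((if N.tgt a ∈ U then 1 else 0) - if N.src a ∈ U then 1 else 0) := by
    rw [← Finset.add_sum_erase _ _ (Finset.mem_univ e)]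
    exact add_le_add hte.le (Finset.sum_le_sum fun a _ => hterm a)
  rw [Finset.sum_const, Finset.card_erase_of_mem (Finset.mem_univ e), nsmul_eq_mul,
    Finset.card_univ, Nat.cast_sub (by exact_mod_cast hcard)] at hsum
  push_cast at hsum
  nlinarith

/-! ### The error of a vector -/

theorem Standing.feasiblePotential_mono (hN : N.Standing) {F : Set E} {f : E → ℝ} {Δ Δ' : ℝ}
    {π : V → ℝ} (h : N.FeasiblePotential F f Δ π) (hΔ : Δ ≤ Δ') :
    N.FeasiblePotential F f Δ' π := by
  refine feasiblePotential_iff.2 ⟨fun e => (h.forward e).trans (hN.dcost_mono e (by linarith)),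
    fun e he => (hN.dcost_mono e (by linarith)).trans (h.backward (he.imp_right hΔ.trans))⟩

theorem Standing.feasible_mono (hN : N.Standing) {F : Set E} {f : E → ℝ} {Δ Δ' : ℝ}
    (h : N.Feasible F f Δ) (hΔ : Δ ≤ Δ') : N.Feasible F f Δ' :=
  ⟨h.1, h.2.imp fun _ hπ => hN.feasiblePotential_mono hπ hΔ⟩

theorem err_nonneg (F : Set E) (f : E → ℝ) : 0 ≤ N.err F f := by
  refine le_sInf ?_
  rintro _ ⟨Δ, hΔ, -, rfl⟩
  exact_mod_cast hΔ.le

theorem err_le {F : Set E} {f : E → ℝ} {Δ : ℝ} (hΔ : 0 < Δ) (h : N.Feasible F f Δ) :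
    N.err F f ≤ Δ :=
  sInf_le ⟨Δ, hΔ, h, rfl⟩

theorem Standing.feasible_of_err_lt (hN : N.Standing) {F : Set E} {f : E → ℝ} {Δ : ℝ}
    (h : N.err F f < Δ) : N.Feasible F f Δ := by
  obtain ⟨_, ⟨Δ', -, hf, rfl⟩, hlt⟩ := sInf_lt_iff.1 h
  exact hN.feasible_mono hf (EReal.coe_lt_coe_iff.1 hlt).le

/-! ### Limits of potentials. -/

theorem IsWalk.potential_sub_le {π : V → ℝ} {M : ℝ} {i j : V} {p : List (E × Bool)}
    (h : N.IsWalk i p j) (hp : ∀ d ∈ p, π (N.dtgt d) - π (N.dsrc d) ≤ M) :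
    π j - π i ≤ p.length * M := by
  induction p generalizing i with
  | nil => obtain rfl : i = j := h; simp
  | cons d p ih =>
    have h1 := ih h.2 fun d' hd' => hp d' (by simp [hd'])
    have h2 := hp d (by simp)
    rw [h.1] at h2
    push_cast [List.length_cons]
    linarith

theorem continuous_potential_sub (i j : V) :
    Continuous fun π : V → ℝ => ((π j - π i : ℝ) : EReal) :=
  continuous_coe_real_ereal.comp ((continuous_apply j).sub (continuous_apply i))

/-- A compactness argument: potentials for all `Δ' > Δ` have a limit potential for `Δ`. -/
theorem Standing.exists_potential_of_forall_gt (hN : N.Standing) {F : Set E} {x : E → ℝ} {Δ : ℝ}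
    (h : ∀ Δ', Δ < Δ' → ∃ π, N.FeasiblePotential F x Δ' π) :
    ∃ π : V → ℝ, (∀ e, ((π (N.tgt e) - π (N.src e) : ℝ) : EReal) ≤ N.dcost e (x e + Δ)) ∧
      ∀ e ∈ F, N.dcost e (x e - Δ) ≤ ((π (N.tgt e) - π (N.src e) : ℝ) : EReal) := by
  obtain ⟨v₀⟩ : Nonempty V := by
    have h2 := hN.two_le
    obtain ⟨e⟩ : Nonempty E := Fintype.card_pos_iff.1 (by omega)
    exact ⟨N.src e⟩
  let ε : ℕ → ℝ := fun k => 1 / ((k : ℝ) + 1)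
  have hε : ∀ k, 0 < ε k := fun k => by positivity
  have hεanti : ∀ k, ε (k + 1) ≤ ε k := fun k => by
    apply one_div_le_one_div_of_le <;> push_cast <;> linarith [(Nat.cast_nonneg k : (0 : ℝ) ≤ k)]
  let t : ℕ → Set (V → ℝ) := fun k => {π | π v₀ = 0 ∧
    (∀ e, ((π (N.tgt e) - π (N.src e) : ℝ) : EReal) ≤ N.dcost e (x e + (Δ + ε k))) ∧
      ∀ e ∈ F, N.dcost e (x e - (Δ + ε k)) ≤ ((π (N.tgt e) - π (N.src e) : ℝ) : EReal)}
  have hclosed : ∀ k, IsClosed (t k) := by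
    intro k
    have h1 : IsClosed {π : V → ℝ | ∀ e,
        ((π (N.tgt e) - π (N.src e) : ℝ) : EReal) ≤ N.dcost e (x e + (Δ + ε k))} := by
      simp only [ofPred_forall]
      exact isClosed_iInter fun e => isClosed_le (continuous_potential_sub _ _) continuous_const
    have h2 : IsClosed {π : V → ℝ | ∀ e ∈ F,
        N.dcost e (x e - (Δ + ε k)) ≤ ((π (N.tgt e) - π (N.src e) : ℝ) : EReal)} := by
      simp only [ofPred_forall]
      exact isClosed_iInter fun e => isClosed_iInter fun _ =>
        isClosed_le continuous_const (continuous_potential_sub _ _)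
    exact (isClosed_eq (continuous_apply v₀) continuous_const).inter (h1.inter h2)
  have hne : ∀ k, (t k).Nonempty := by
    intro k
    obtain ⟨π, hπ⟩ := h (Δ + ε k) (by linarith [hε k])
    refine ⟨fun v => π v - π v₀, by simp, fun e => ?_, fun e he => ?_⟩
    · simpa only [sub_sub_sub_cancel_right] using hπ.forward e
    · simpa only [sub_sub_sub_cancel_right] using hπ.backward (Or.inl he)
  have hanti : ∀ k, t (k + 1) ⊆ t k := by
    rintro k π ⟨h0, h1, h2⟩
    exact ⟨h0, fun e => (h1 e).trans (hN.dcost_mono e (by linarith [hεanti k])),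
      fun e he => (hN.dcost_mono e (by linarith [hεanti k])).trans (h2 e he)⟩
  have hcompact : IsCompact (t 0) := by
    -- The forward inequalities bound `π` along forward walks; strong connectivity provides such
    -- walks to and from `v₀`, hence bounds on both sides.
    set M : ℝ := ∑ e, |(N.dcost e (x e + (Δ + ε 0))).toReal| with hM
    choose p hp hpt using fun i j => hN.exists_walk i j
    let B : V → ℝ := fun i => ((p v₀ i).length + (p i v₀).length) * M
    have hM0 : 0 ≤ M := Finset.sum_nonneg fun _ _ => abs_nonneg _
    refine IsCompact.of_isClosed_subset (isCompact_univ_pi fun i => isCompact_Icc)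
      (hclosed 0) (s := Set.pi univ fun i => Icc (-B i) (B i)) ?_
    rintro π ⟨h0, h1, -⟩ i -
    have harc : ∀ e, π (N.tgt e) - π (N.src e) ≤ M := by
      intro e
      have h3 : π (N.tgt e) - π (N.src e) ≤ (N.dcost e (x e + (Δ + ε 0))).toReal := by
        rw [← EReal.coe_le_coe_iff, EReal.coe_toReal (N.dcost_ne_top e _)]
        · exact h1 e
        · intro hbot
          have := h1 e
          rw [hbot] at this
          exact absurd this (not_le.2 (EReal.bot_lt_coe _))
      refine h3.trans ((le_abs_self _).trans ?_)
      exact Finset.single_le_sum (f := fun e => |(N.dcost e (x e + (Δ + ε 0))).toReal|)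
        (fun _ _ => abs_nonneg _) (Finset.mem_univ e)
    have hwalk : ∀ a b, π b - π a ≤ (p a b).length * M := fun a b =>
      (hp a b).potential_sub_le fun d hd => by
        have := hpt a b d hd
        obtain ⟨e, b'⟩ := d
        obtain rfl : b' = true := this
        exact harc e
    have h4 := hwalk v₀ i
    have h5 := hwalk i v₀
    rw [h0] at h4 h5
    have h6 : 0 ≤ ((p v₀ i).length : ℝ) * M := by positivity
    have h7 : 0 ≤ ((p i v₀).length : ℝ) * M := by positivity
    constructor <;> simp only [B, add_mul] <;> linarith
  obtain ⟨π, hπ⟩ := IsCompact.nonempty_iInter_of_sequence_nonempty_isCompact_isClosed t hanti hne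
    hcompact hclosed
  have hπk : ∀ k, π ∈ t k := fun k => mem_iInter.1 hπ k
  have hlim : Tendsto (fun k => Δ + ε k) atTop (𝓝 Δ) := by
    simpa [ε] using (tendsto_one_div_add_atTop_nhds_zero_nat (𝕜 := ℝ)).const_add Δ
  refine ⟨π, fun e => ?_, fun e he => ?_⟩
  · exact ge_of_tendsto' (((hN.dcost_continuous e).tendsto _).comp (hlim.const_add (x e)))
      fun k => (hπk k).2.1 e
  · exact le_of_tendsto' (((hN.dcost_continuous e).tendsto _).comp (hlim.const_sub (x e)))
      fun k => (hπk k).2.2 e he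

theorem Standing.exists_potential_of_err_le (hN : N.Standing) {F : Set E} {x : E → ℝ} {Δ : ℝ}
    (h : N.err F x ≤ Δ) :
    ∃ π : V → ℝ, (∀ e, ((π (N.tgt e) - π (N.src e) : ℝ) : EReal) ≤ N.dcost e (x e + Δ)) ∧
      ∀ e ∈ F, N.dcost e (x e - Δ) ≤ ((π (N.tgt e) - π (N.src e) : ℝ) : EReal) :=
  hN.exists_potential_of_forall_gt fun _ hlt =>
    (hN.feasible_of_err_lt (h.trans_lt (EReal.coe_lt_coe_iff.2 hlt))).2

theorem isPseudoflow_of_eq_zero {F : Set E} {x : E → ℝ} (hx : ∀ e, e ∉ F → x e = 0) :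
    N.IsPseudoflow F x :=
  fun e he => (hx e he).ge

/-- In the limit one could miss a backward arc of flow exactly `Δ`, which is absent from `E_f(Δ')`
for `Δ' > Δ`. As `x` vanishes off `F`, the only backward arcs are those of `F`, which are always
present. -/
theorem Standing.feasible_of_err_le (hN : N.Standing) {F : Set E} {x : E → ℝ} {Δ : ℝ}
    (hx : ∀ e, e ∉ F → x e = 0) (hΔ : 0 < Δ) (h : N.err F x ≤ Δ) : N.Feasible F x Δ := by
  obtain ⟨π, h1, h2⟩ := hN.exists_potential_of_err_le h
  refine ⟨isPseudoflow_of_eq_zero hx, π, feasiblePotential_iff.2 ⟨h1, fun e he => h2 e ?_⟩⟩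
  by_contra hF
  have := he.resolve_left hF
  rw [hx e hF] at this
  linarith

theorem Standing.fOptimal_of_err_eq_zero (hN : N.Standing) {F : Set E} {x : E → ℝ}
    (hx : ∀ e, e ∉ F → x e = 0) (h : N.err F x = 0) (hex : N.excess N.demand x = 0) :
    N.FOptimal F x := by
  obtain ⟨π, h1, h2⟩ := hN.exists_potential_of_err_le (Δ := 0) (by simpa using h.le)
  refine ⟨isPseudoflow_of_eq_zero hx, hex, π, optPotential_iff.2 ⟨by simpa using h1, fun e he => ?_⟩⟩
  have heF : e ∈ F := by
    by_contra hF
    have := he.resolve_left hF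
    rw [hx e hF] at this
    exact lt_irrefl _ this
  simpa using h2 e heF

/-! ### Augmentations -/

theorem list_sum_coe {l : List (E × Bool)} {c : E × Bool → EReal}
    (h : ∀ d ∈ l, c d ≠ ⊤ ∧ c d ≠ ⊥) :
    (l.map c).sum = (((l.map fun d => (c d).toReal).sum : ℝ) : EReal) := by
  induction l with
  | nil => simp
  | cons d l ih =>
    rw [List.map_cons, List.sum_cons, List.map_cons, List.sum_cons,
      ih fun d' hd' => h d' (by simp [hd']), EReal.coe_add,
      EReal.coe_toReal (h d (by simp)).1 (h d (by simp)).2]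

/-- In `EReal` the sum `⊥ + ⊤` is `⊥`, so a `⊤` could be hidden by a `⊥`; the first hypothesis
excludes this. -/
theorem ne_top_of_list_sum {l : List (E × Bool)} {c : E × Bool → EReal} (hb : ∀ d ∈ l, c d ≠ ⊥)
    (h : (l.map c).sum ≠ ⊤) : ∀ d ∈ l, c d ≠ ⊤ := by
  have hsum : ∀ l : List (E × Bool), (∀ d ∈ l, c d ≠ ⊥) → (l.map c).sum ≠ ⊥ := by
    intro l
    induction l with
    | nil => simp
    | cons d l ih =>
      intro hl
      rw [List.map_cons, List.sum_cons, Ne, EReal.add_eq_bot_iff, not_or]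
      exact ⟨hl d (by simp), ih fun d' hd' => hl d' (by simp [hd'])⟩
  induction l with
  | nil => simp
  | cons d l ih =>
    have hl : ∀ d' ∈ l, c d' ≠ ⊥ := fun d' hd' => hb d' (by simp [hd'])
    rw [List.map_cons, List.sum_cons] at h
    have h1 : c d ≠ ⊤ := fun h1 => h (by rw [h1, EReal.top_add_of_ne_bot (hsum l hl)])
    have h2 : (l.map c).sum ≠ ⊤ := fun h2 => h (by
      rw [h2, EReal.add_top_of_ne_bot (hb d (by simp))])
    intro d' hd'
    rcases List.mem_cons.1 hd' with rfl | hd'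
    exacts [h1, ih hl h2 d' hd']

theorem IsWalk.sum_sub_potential {π : V → ℝ} {i j : V} {p : List (E × Bool)}
    (h : N.IsWalk i p j) (c : E × Bool → ℝ) :
    (p.map fun d => c d - (π (N.dtgt d) - π (N.dsrc d))).sum = (p.map c).sum - (π j - π i) := by
  induction p generalizing i with
  | nil => obtain rfl : i = j := h; simp
  | cons d p ih =>
    rw [List.map_cons, List.sum_cons, ih h.2, List.map_cons, List.sum_cons, h.1]
    ring

theorem IsWalk.potential_le_add_sum {D : V → ℝ} {w : E × Bool → ℝ} {i j : V}
    {p : List (E × Bool)} (h : N.IsWalk i p j)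
    (hp : ∀ d ∈ p, D (N.dtgt d) ≤ D (N.dsrc d) + w d) : D j ≤ D i + (p.map w).sum := by
  induction p generalizing i with
  | nil => obtain rfl : i = j := h; simp
  | cons d p ih =>
    have h1 := ih h.2 fun d' hd' => hp d' (by simp [hd'])
    have h2 := hp d (by simp)
    rw [h.1] at h2
    rw [List.map_cons, List.sum_cons]
    linarith

theorem IsWalk.tight_of_sum_le {D : V → ℝ} {w : E × Bool → ℝ} {i j : V}
    {p : List (E × Bool)} (h : N.IsWalk i p j)
    (hp : ∀ d ∈ p, D (N.dtgt d) ≤ D (N.dsrc d) + w d) (hs : (p.map w).sum ≤ D j - D i) :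
    ∀ d ∈ p, D (N.dtgt d) = D (N.dsrc d) + w d := by
  induction p generalizing i with
  | nil => simp
  | cons d p ih =>
    have hp' : ∀ d' ∈ p, D (N.dtgt d') ≤ D (N.dsrc d') + w d' := fun d' hd' => hp d' (by simp [hd'])
    have h1 := h.2.potential_le_add_sum hp'
    have h2 := hp d (by simp)
    rw [List.map_cons, List.sum_cons] at hs
    have h3 := h.1
    intro d' hd'
    rcases List.mem_cons.1 hd' with rfl | hd'
    · rw [h3] at h2 ⊢
      linarith
    · refine ih h.2 hp' ?_ d' hd'
      rw [h3] at h2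
      linarith

theorem FeasiblePotential.dartCost_ne_bot {F : Set E} {f : E → ℝ} {Δ : ℝ} {π : V → ℝ}
    (h : N.FeasiblePotential F f Δ π) {d : E × Bool} (hd : d ∈ N.residualAt F f Δ) :
    N.dartCost f Δ d ≠ ⊥ := fun hb => by
  have := h d hd
  rw [hb] at this
  exact absurd this (not_le.2 (EReal.bot_lt_coe _))

theorem Standing.exists_forward_path (hN : N.Standing) (i j : V) :
    ∃ p, N.IsPath i p j ∧ ∀ d ∈ p, d.2 = true := by
  obtain ⟨p, hp, hpt⟩ := hN.exists_walk i j
  obtain ⟨q, hq, hs⟩ := hp.exists_path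
  exact ⟨q, hq, fun d hd => hpt d (hs.subset hd)⟩

theorem Standing.exists_shortestPath (hN : N.Standing) (s : State E) (i j : V) :
    ∃ p, N.IsShortestPath s i p j := by
  obtain ⟨q, hq, hqt⟩ := hN.exists_forward_path i j
  obtain ⟨p, hp, hmin⟩ := Set.exists_min_image
    {p | N.IsPath i p j ∧ ∀ d ∈ p, d ∈ N.residualAt s.revealed s.flow s.scale}
    (fun p => (p.map (N.dartCost s.flow s.scale)).sum)
    ((finite_paths i j).subset fun p hp => hp.1) ⟨q, hq, fun d hd => Or.inl (hqt d hd)⟩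
  exact ⟨p, hp, fun q hq hqr => hmin q ⟨hq, hqr⟩⟩

/-- Shortest path distances yield a potential that is tight on a given shortest path. -/
theorem Standing.exists_tight_potential (hN : N.Standing) {s : State E} {i j : V}
    {p : List (E × Bool)} {π : V → ℝ}
    (hπ : N.FeasiblePotential s.revealed s.flow s.scale π) (hp : N.IsShortestPath s i p j) :
    ∃ π' : V → ℝ, N.FeasiblePotential s.revealed s.flow s.scale π' ∧
      ∀ d ∈ p, ((π' (N.dtgt d) - π' (N.dsrc d) : ℝ) : EReal) = N.dartCost s.flow s.scale d := by
  set c := N.dartCost s.flow s.scale with hc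
  set R₀ := N.residualAt s.revealed s.flow s.scale with hR₀
  -- Reversals of restricted arcs may cost `⊤`. They impose no constraint, and without them the
  -- reduced costs `w` are nonnegative reals.
  set R : Set (E × Bool) := {d | d ∈ R₀ ∧ c d ≠ ⊤} with hR
  set w : E × Bool → ℝ := fun d => (c d).toReal - (π (N.dtgt d) - π (N.dsrc d)) with hw
  have hcoe : ∀ d ∈ R, (((c d).toReal : ℝ) : EReal) = c d := fun d hd =>
    EReal.coe_toReal hd.2 (hπ.dartCost_ne_bot hd.1)
  have hw0 : ∀ d ∈ R, 0 ≤ w d := by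
    intro d hd
    have := hπ d hd.1
    rw [← hc, ← hcoe d hd, EReal.coe_le_coe_iff] at this
    exact sub_nonneg.2 this
  have hforward : ∀ q : List (E × Bool), (∀ d ∈ q, d.2 = true) → ∀ d ∈ q, d ∈ R := by
    intro q hq d hd
    refine ⟨Or.inl (hq d hd), ?_⟩
    simp only [hc, dartCost, hq d hd, if_true]
    exact N.dcost_ne_top _ _
  have hsum : ∀ q : List (E × Bool), (∀ d ∈ q, d ∈ R) →
      (q.map c).sum = (((q.map fun d => (c d).toReal).sum : ℝ) : EReal) := fun q hq =>
    list_sum_coe fun d hd => ⟨(hq d hd).2, hπ.dartCost_ne_bot (hq d hd).1⟩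
  -- A forward path has cost below `⊤`, so the shortest path uses no arc of cost `⊤`.
  have hpR : ∀ d ∈ p, d ∈ R := by
    obtain ⟨q, hq, hqt⟩ := hN.exists_forward_path i j
    have hqR := hforward q hqt
    have hle := hp.2 q hq fun d hd => (hqR d hd).1
    rw [← hc, hsum q hqR] at hle
    exact fun d hd => ⟨hp.1.2 d hd, ne_top_of_list_sum
      (fun d hd => hπ.dartCost_ne_bot (hp.1.2 d hd)) (ne_top_of_le_ne_top (EReal.coe_ne_top _) hle) d hd⟩
  -- Lengths of walks from `i`. Since `w ≥ 0`, passing to a path does not lengthen a walk, so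
  -- shortest paths are also shortest walks.
  let A : V → Set ℝ := fun v => {r | ∃ q, N.IsWalk i q v ∧ (∀ d ∈ q, d ∈ R) ∧ r = (q.map w).sum}
  have hA0 : ∀ v, ∀ r ∈ A v, 0 ≤ r := by
    rintro v _ ⟨q, -, hqR, rfl⟩
    refine List.sum_nonneg fun r hr => ?_
    obtain ⟨d, hd, rfl⟩ := List.mem_map.1 hr
    exact hw0 d (hqR d hd)
  have hAbdd : ∀ v, BddBelow (A v) := fun v => ⟨0, hA0 v⟩
  have hAne : ∀ v, (A v).Nonempty := by
    intro v
    obtain ⟨q, hq, hqt⟩ := hN.exists_walk i v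
    exact ⟨_, q, hq, hforward q hqt, rfl⟩
  let D : V → ℝ := fun v => sInf (A v)
  have htri : ∀ d ∈ R, D (N.dtgt d) ≤ D (N.dsrc d) + w d := by
    intro d hd
    rw [← sub_le_iff_le_add]
    refine le_csInf (hAne _) ?_
    rintro _ ⟨q, hq, hqR, rfl⟩
    rw [sub_le_iff_le_add]
    refine csInf_le (hAbdd _) ⟨q ++ [d], isWalk_append.2 ⟨_, hq, isWalk_singleton.2 ⟨rfl, rfl⟩⟩,
      fun d' hd' => ?_, by simp⟩
    rcases List.mem_append.1 hd' with h | h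
    · exact hqR d' h
    · rw [List.mem_singleton.1 h]; exact hd
  have hDi : D i ≤ 0 := csInf_le (hAbdd i) ⟨[], rfl, by simp, by simp⟩
  have hDj : (p.map w).sum ≤ D j := by
    refine le_csInf (hAne j) ?_
    rintro _ ⟨q, hq, hqR, rfl⟩
    obtain ⟨q', hq', hs⟩ := hq.exists_path
    have hqR' : ∀ d ∈ q', d ∈ R := fun d hd => hqR d (hs.subset hd)
    have h1 := hp.2 q' hq' fun d hd => (hqR' d hd).1
    rw [← hc, hsum p hpR, hsum q' hqR', EReal.coe_le_coe_iff] at h1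
    have h2 : (p.map w).sum ≤ (q'.map w).sum := by
      rw [hp.1.1.1.sum_sub_potential, hq'.1.sum_sub_potential]
      linarith
    refine h2.trans ((hs.map w).sum_le_sum fun r hr => ?_)
    obtain ⟨d, hd, rfl⟩ := List.mem_map.1 hr
    exact hw0 d (hqR d hd)
  -- The triangle inequalities along `p` telescope to an equality, so each of them is an equality.
  have htight := hp.1.1.1.tight_of_sum_le (fun d hd => htri d (hpR d hd)) (by linarith)
  refine ⟨fun v => π v + D v, fun d hd => ?_, fun d hd => ?_⟩
  · by_cases hdR : c d = ⊤
    · rw [← hc, hdR]; exact le_top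
    · have h1 := htri d ⟨hd, hdR⟩
      rw [← hc, ← hcoe d ⟨hd, hdR⟩, EReal.coe_le_coe_iff]
      simp only [hw] at h1
      linarith
  · have h1 := htight d hd
    rw [← hcoe d (hpR d hd), EReal.coe_eq_coe_iff]
    simp only [hw] at h1
    linarith

/-- For a potential tight on the path, each changed arc satisfies `π_j - π_i = C'` at its new flow;
both inequalities then follow by monotonicity. -/
theorem Standing.feasible_push (hN : N.Standing) {s : State E} (hΔ : 0 < s.scale) {i j : V}
    {p : List (E × Bool)} (hf : N.Feasible s.revealed s.flow s.scale)
    (hp : N.IsShortestPath s i p j) :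
    N.Feasible s.revealed (push s.flow p s.scale) s.scale := by
  obtain ⟨hf0, π₀, hπ₀⟩ := hf
  obtain ⟨π, hπ, hpt⟩ := hN.exists_tight_potential hπ₀ hp
  have hnd := hp.1.1.nodup_arcs
  have hcases : ∀ e, push s.flow p s.scale e = s.flow e ∨
      (push s.flow p s.scale e = s.flow e + s.scale ∧
        ((π (N.tgt e) - π (N.src e) : ℝ) : EReal) = N.dcost e (s.flow e + s.scale)) ∨
      (push s.flow p s.scale e = s.flow e - s.scale ∧ (e ∈ s.revealed ∨ s.scale ≤ s.flow e) ∧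
        ((π (N.tgt e) - π (N.src e) : ℝ) : EReal) = N.dcost e (s.flow e - s.scale)) := by
    intro e
    by_cases he : ∃ d ∈ p, d.1 = e
    · obtain ⟨d, hd, rfl⟩ := he
      have h1 := push_of_mem (f := s.flow) (δ := s.scale) hnd hd
      have h2 := hpt d hd
      have h3 := hp.1.2 d hd
      obtain ⟨e, _ | _⟩ := d
      · refine Or.inr (Or.inr ⟨by simpa [sub_eq_add_neg] using h1, by simpa [residualAt] using h3, ?_⟩)
        simp only [dartCost, dtgt_false, dsrc_false, Bool.false_eq_true, if_false] at h2
        rw [← neg_neg (N.dcost _ _), ← h2, ← EReal.coe_neg, neg_sub]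
      · exact Or.inr (Or.inl ⟨by simpa using h1, by simpa [dartCost] using h2⟩)
    · push Not at he
      exact Or.inl (push_of_notMem he)
  refine ⟨fun e he => ?_, π, feasiblePotential_iff.2 ⟨fun e => ?_, fun e he => ?_⟩⟩
  · have := hf0 e he
    rcases hcases e with h | ⟨h, -⟩ | ⟨h, h', -⟩ <;> rw [h]
    · exact this
    · linarith
    · linarith [h'.resolve_left he]
  · rcases hcases e with h | ⟨h, h'⟩ | ⟨h, -, h'⟩ <;> rw [h]
    · exact hπ.forward e
    · rw [h']; exact hN.dcost_mono e (by linarith)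
    · rw [h']; exact hN.dcost_mono e (by linarith)
  · rcases hcases e with h | ⟨h, h'⟩ | ⟨h, -, h'⟩ <;> rw [h] at he ⊢
    · exact hπ.backward he
    · rw [h']; exact hN.dcost_mono e (by linarith)
    · rw [h']; exact hN.dcost_mono e (by linarith)

/-! ### The main part of a phase -/

theorem Standing.sum_sub_demand (hN : N.Standing) (f : E → ℝ) :
    ∑ i, (N.netInflow f i - N.demand i) = 0 := by
  rw [Finset.sum_sub_distrib, sum_netInflow, hN.balanced, sub_zero]

theorem Standing.excess_eq_deficit (hN : N.Standing) (f : E → ℝ) :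
    N.excess N.demand f = ∑ i, max (-(N.netInflow f i - N.demand i)) 0 := by
  have h : ∀ r : ℝ, max r 0 = r + max (-r) 0 := fun r => by
    rcases le_total r 0 with h | h
    · rw [max_eq_right h, max_eq_left (by linarith)]; ring
    · rw [max_eq_left h, max_eq_right (by linarith)]; ring
  unfold excess
  simp_rw [h (N.netInflow f _ - N.demand _)]
  rw [Finset.sum_add_distrib, hN.sum_sub_demand, zero_add]

theorem Standing.sum_abs_sub_demand (hN : N.Standing) (f : E → ℝ) :
    ∑ i, |N.netInflow f i - N.demand i| = 2 * N.excess N.demand f := by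
  have h : ∀ r : ℝ, |r| = max r 0 + max (-r) 0 := fun r => by
    rcases le_total r 0 with h | h
    · rw [max_eq_right h, max_eq_left (by linarith), abs_of_nonpos h]; ring
    · rw [max_eq_left h, max_eq_right (by linarith), abs_of_nonneg h]; ring
  simp_rw [h (N.netInflow f _ - N.demand _)]
  rw [Finset.sum_add_distrib, ← hN.excess_eq_deficit, two_mul]
  rfl

theorem Standing.netInflow_eq_of_excess_eq_zero (hN : N.Standing) {f : E → ℝ}
    (h : N.excess N.demand f = 0) (i : V) : N.netInflow f i = N.demand i := by
  have h1 := hN.sum_abs_sub_demand f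
  rw [h, mul_zero, Finset.sum_eq_zero_iff_of_nonneg fun _ _ => abs_nonneg _] at h1
  exact sub_eq_zero.1 (abs_eq_zero.1 (h1 i (Finset.mem_univ i)))

theorem Standing.excess_le_of_mainDone (hN : N.Standing) {s : State E} (hΔ : 0 < s.scale)
    (h : N.MainDone s) : N.excess N.demand s.flow ≤ Fintype.card V * s.scale := by
  have hle : ∀ g : V → ℝ, (∀ i, g i ≤ s.scale) →
      ∑ i, max (g i) 0 ≤ Fintype.card V * s.scale := by
    intro g hg
    refine (Finset.sum_le_sum fun i _ => max_le (hg i) hΔ.le).trans ?_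
    simp
  rcases h with h | h
  · exact hle _ fun i => (not_le.1 fun hi => (h ▸ (show i ∈ N.sources s from hi) : i ∈ (∅ : Set V))).le
  · rw [hN.excess_eq_deficit]
    refine hle _ fun i => (not_lt.1 fun hi => ?_)
    have : i ∈ N.sinks s := by
      show N.netInflow s.flow i - N.demand i ≤ -s.scale
      linarith
    rw [h] at this
    exact this

theorem sum_unitMass (i : V) : ∑ k, unitMass i k = 1 := by
  classical
  rw [Finset.sum_eq_single i (fun k _ hk => unitMass_of_ne hk) (by simp), unitMass_self]

/-- The source has excess at least `Δ` and the sink deficit at least `Δ`, so moving `Δ` does not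
flip either sign. -/
theorem Augment.excess {s s' : State E} (hΔ : 0 < s.scale) (h : N.Augment s s') :
    N.excess N.demand s'.flow = N.excess N.demand s.flow - s.scale := by
  obtain ⟨i, hi, j, hj, p, hp, rfl⟩ := h
  have hi' : s.scale ≤ N.netInflow s.flow i - N.demand i := hi
  have hj' : N.netInflow s.flow j - N.demand j ≤ -s.scale := hj
  have hij : i ≠ j := by
    rintro rfl
    linarith
  have hterm : ∀ k, max (N.netInflow (push s.flow p s.scale) k - N.demand k) 0 =
      max (N.netInflow s.flow k - N.demand k) 0 - s.scale * unitMass i k := by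
    intro k
    rw [netInflow_push hp.1.1.1]
    by_cases hki : k = i
    · subst hki
      rw [unitMass_self, unitMass_of_ne hij, max_eq_left (by linarith), max_eq_left (by linarith)]
      ring
    · rw [unitMass_of_ne hki]
      by_cases hkj : k = j
      · subst hkj
        rw [unitMass_self, max_eq_right (by linarith), max_eq_right (by linarith)]
        ring
      · rw [unitMass_of_ne hkj]
        simp
  unfold FlowNetwork.excess
  simp_rw [hterm]
  rw [Finset.sum_sub_distrib, ← Finset.mul_sum, sum_unitMass, mul_one]

theorem Augment.scale_eq {s s' : State E} (h : N.Augment s s') : s'.scale = s.scale := by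
  obtain ⟨i, -, j, -, p, -, rfl⟩ := h; rfl

theorem Augment.revealed_eq {s s' : State E} (h : N.Augment s s') : s'.revealed = s.revealed := by
  obtain ⟨i, -, j, -, p, -, rfl⟩ := h; rfl

theorem not_forall_augment {t : ℕ → State E} (hΔ : 0 < (t 0).scale) :
    ¬ ∀ j, N.Augment (t j) (t (j + 1)) := by
  intro h
  have key : ∀ j : ℕ, (t j).scale = (t 0).scale ∧
      N.excess N.demand (t j).flow = N.excess N.demand (t 0).flow - j * (t 0).scale := by
    intro j
    induction j with
    | zero => simp
    | succ j ih =>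
      refine ⟨(h j).scale_eq.trans ih.1, ?_⟩
      rw [(h j).excess (by rw [ih.1]; exact hΔ), ih.1, ih.2]
      push_cast; ring
  obtain ⟨j, hj⟩ := exists_nat_gt (N.excess N.demand (t 0).flow / (t 0).scale)
  rw [div_lt_iff₀ hΔ] at hj
  have := (key j).2
  have := N.excess_nonneg N.demand (t j).flow
  linarith

theorem Standing.augment_or_mainDone (hN : N.Standing) (s : State E) :
    (∃ s', N.Augment s s') ∨ N.MainDone s := by
  by_cases h : N.MainDone s
  · exact Or.inr h
  · simp only [MainDone, not_or, ← Set.nonempty_iff_ne_empty] at h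
    obtain ⟨⟨i, hi⟩, j, hj⟩ := h
    obtain ⟨p, hp⟩ := hN.exists_shortestPath s i j
    exact Or.inl ⟨_, i, hi, j, hj, p, hp, rfl⟩

theorem Standing.feasible_of_augment (hN : N.Standing) {s t : State E} (hΔ : 0 < s.scale)
    (hf : N.Feasible s.revealed s.flow s.scale) (h : Relation.ReflTransGen N.Augment s t) :
    t.scale = s.scale ∧ t.revealed = s.revealed ∧ N.Feasible t.revealed t.flow t.scale := by
  induction h with
  | refl => exact ⟨rfl, rfl, hf⟩
  | tail _ hst ih =>
    obtain ⟨h1, h2, h3⟩ := ih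
    refine ⟨hst.scale_eq.trans h1, hst.revealed_eq.trans h2, ?_⟩
    obtain ⟨i, -, j, -, p, hp, rfl⟩ := hst
    exact hN.feasible_push (h1 ▸ hΔ) h3 hp

/-! ### Extending the revealed set -/

theorem netInflow_update (g : E → ℝ) [DecidableEq E] (e : E) (i : V) :
    N.netInflow (Function.update g e 0) i =
      N.netInflow g i - g e * (unitMass (N.tgt e) i - unitMass (N.src e) i) := by
  classical
  have : Function.update g e 0 = fun a => g a + if e = a then -(g e) else 0 := by
    funext a
    by_cases h : a = e
    · subst h; simp
    · simp [h, Ne.symm h]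
  have h2 := N.netInflow_single e (-(g e)) i
  rw [this, netInflow_add]
  convert congrArg (N.netInflow g i + ·) h2 using 1
  · congr! 
  · ring

/-- One potential serves throughout. An added arc has flow at least `Δ`, so its reversal was already
constrained. Rerouting alters only linear arcs, whose `C'` is constant, and the emptied arc loses
its backward constraint. Arcs still in the list lie outside `F`, so earlier rerouting leaves them
untouched. -/
theorem ExtendLoop.spec {l : List E} {f f' : E → ℝ} {F F' : Set E} {Δ : ℝ} {π : V → ℝ}
    (h : N.ExtendLoop l f F f' F') (hΔ : 0 < Δ) (hl : l.Nodup) (hlF : ∀ e ∈ l, e ∉ F ∧ Δ ≤ f e)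
    (hF : N.LinearAcyclic F) (hf : N.IsPseudoflow F f) (hπ : N.FeasiblePotential F f Δ π) :
    (N.LinearAcyclic F' ∧ F ⊆ F' ∧ (∀ e ∈ F', e ∈ F ∨ e ∈ l)) ∧
      (N.IsPseudoflow F' f' ∧ N.FeasiblePotential F' f' Δ π) ∧
      (∀ i, N.netInflow f' i = N.netInflow f i) ∧
      (∀ e, e ∉ F' → (e ∈ l → f' e = 0) ∧ (e ∉ l → f' e = f e)) := by
  classical
  induction h with
  | nil f F => simp [hF, hf, hπ]
  | add e l f f' F F' hacyc _ ih =>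
    rw [List.nodup_cons] at hl
    have he := hlF e (by simp)
    have hbig : ∀ a ∈ l, a ∉ insert e F ∧ Δ ≤ f a := by
      refine fun a ha => ⟨fun hmem => ?_, (hlF a (by simp [ha])).2⟩
      rcases hmem with rfl | hmem
      · exact hl.1 ha
      · exact (hlF a (by simp [ha])).1 hmem
    have hπ' : N.FeasiblePotential (insert e F) f Δ π := by
      refine feasiblePotential_iff.2 ⟨hπ.forward, fun a ha => ?_⟩
      rcases ha with (rfl | ha) | ha
      · exact hπ.backward (Or.inr he.2)
      · exact hπ.backward (Or.inl ha)
      · exact hπ.backward (Or.inr ha)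
    obtain ⟨⟨h1, h2, h3⟩, h4, h5, h6⟩ := ih hl.2 hbig hacyc
      (fun a ha => hf a fun h => ha (Or.inr h)) hπ'
    have heF' : e ∈ F' := h2 (mem_insert _ _)
    refine ⟨⟨h1, (subset_insert _ _).trans h2, fun a ha => ?_⟩, h4, h5, fun a ha => ?_⟩
    · rcases h3 a ha with (rfl | h) | h <;> simp [*]
    · have hne : a ≠ e := fun h => ha (h ▸ heF')
      simpa [hne] using h6 a ha
  | reroute e l f f' F F' p hacyc hp hpF _ ih =>
    rw [List.nodup_cons] at hl
    have he := hlF e (by simp)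
    have hlin := (hF.exists_path hacyc).1
    have hval : ∀ a, a ≠ e → a ∉ F ∨ ¬ N.IsLinear a →
        Function.update (push f p (f e)) e 0 a = f a := by
      intro a hae ha
      rw [Function.update_of_ne hae]
      refine push_of_notMem fun d hd heq => ?_
      rcases ha with ha | ha
      · exact ha (heq ▸ (hpF d hd).1)
      · exact ha (heq ▸ (hpF d hd).2)
    have hpe : push f p (f e) e = f e := push_of_notMem fun d hd heq => he.1 (heq ▸ (hpF d hd).1)
    have hbig : ∀ a ∈ l, a ∉ F ∧ Δ ≤ Function.update (push f p (f e)) e 0 a := by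
      intro a ha
      have h8 := hlF a (by simp [ha])
      rw [hval a (fun h => hl.1 (h ▸ ha)) (Or.inl h8.1)]
      exact h8
    have hf' : N.IsPseudoflow F (Function.update (push f p (f e)) e 0) := by
      intro a ha
      by_cases hae : a = e
      · subst hae; simp
      · rw [hval a hae (Or.inl ha)]; exact hf a ha
    have hπ' : N.FeasiblePotential F (Function.update (push f p (f e)) e 0) Δ π := by
      refine feasiblePotential_iff.2 ⟨fun a => ?_, fun a ha => ?_⟩
      · by_cases hal : N.IsLinear a
        · rw [hal.dcost_eq _ (f a + Δ)]; exact hπ.forward a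
        · rw [hval a (fun h => hal (h ▸ hlin)) (Or.inr hal)]; exact hπ.forward a
      · by_cases hae : a = e
        · subst hae
          rw [Function.update_self] at ha
          exact absurd (ha.resolve_left he.1) (not_le.2 hΔ)
        · by_cases haF : a ∈ F
          · by_cases hal : N.IsLinear a
            · rw [hal.dcost_eq _ (f a - Δ)]; exact hπ.backward (Or.inl haF)
            · rw [hval a hae (Or.inr hal)]; exact hπ.backward (Or.inl haF)
          · rw [hval a hae (Or.inl haF)] at ha ⊢; exact hπ.backward ha
    obtain ⟨⟨h1, h2, h3⟩, h4, h5, h6⟩ := ih hl.2 hbig hF hf' hπ'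
    refine ⟨⟨h1, h2, fun a ha => ?_⟩, h4, fun i => ?_, fun a ha => ?_⟩
    · rcases h3 a ha with h | h <;> simp [h]
    · rw [h5, netInflow_update, netInflow_push hp.1, hpe]; ring
    · have h8 := h6 a ha
      have haF : a ∉ F := fun h => ha (h2 h)
      by_cases hae : a = e
      · subst hae
        simpa using h8.2 hl.1
      · rw [hval a hae (Or.inl haF)] at h8
        simpa [hae] using h8

theorem LinearAcyclic.exists_extendLoop (l : List E) (f : E → ℝ) {F : Set E}
    (hF : N.LinearAcyclic F) : ∃ f' F', N.ExtendLoop l f F f' F' := by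
  induction l generalizing f F with
  | nil => exact ⟨f, F, .nil f F⟩
  | cons e l ih =>
    by_cases h : N.LinearAcyclic (insert e F)
    · obtain ⟨f', F', hl⟩ := ih f h
      exact ⟨f', F', .add e l f f' F F' h hl⟩
    · obtain ⟨-, p, hp, hpF⟩ := hF.exists_path h
      obtain ⟨f', F', hl⟩ := ih _ hF
      exact ⟨f', F', .reroute e l f f' F F' p h hp hpF hl⟩

theorem exists_extend {s : State E} (hF : N.LinearAcyclic s.revealed) : ∃ s', N.Extend s s' := by
  classical
  obtain ⟨f', F', h⟩ := hF.exists_extendLoop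
    (Finset.univ.filter fun e => e ∉ s.revealed ∧
      (2 * Fintype.card V + Fintype.card E + 1 : ℝ) * s.scale < s.flow e).toList s.flow
  exact ⟨⟨f', s.scale, F'⟩, _, Finset.nodup_toList _, by simp, h, rfl⟩

/-- What `Extend` does after a completed main part. -/
structure ExtendSpec (N : FlowNetwork V E) (s s' : State E) : Prop where
  scale_eq : s'.scale = s.scale
  acyclic : N.LinearAcyclic s'.revealed
  subset : s.revealed ⊆ s'.revealed
  tight : s'.revealed ⊆ N.tightArcs
  feasible : N.Feasible s'.revealed s'.flow s'.scale
  excess_le : N.excess N.demand s'.flow ≤ Fintype.card V * s'.scale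
  small : ∀ e, e ∉ s'.revealed →
    s'.flow e ≤ (2 * Fintype.card V + Fintype.card E + 1) * s'.scale

theorem Standing.extendSpec (hN : N.Standing) {s s' : State E} (hΔ : 0 < s.scale)
    (hf : N.Feasible s.revealed s.flow s.scale) (hF : N.LinearAcyclic s.revealed)
    (ht : s.revealed ⊆ N.tightArcs) (hm : N.MainDone s) (h : N.Extend s s') :
    N.ExtendSpec s s' := by
  obtain ⟨l, hl, hmem, hloop, hsc⟩ := h
  obtain ⟨hf0, π, hπ⟩ := hf
  have hex := hN.excess_le_of_mainDone hΔ hm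
  have hbig : ∀ e ∈ l, e ∉ s.revealed ∧ s.scale ≤ s.flow e := by
    intro e he
    obtain ⟨h1, h2⟩ := (hmem e).1 he
    refine ⟨h1, le_trans ?_ h2.le⟩
    have : (1 : ℝ) ≤ 2 * Fintype.card V + Fintype.card E + 1 := by
      have : (0 : ℝ) ≤ 2 * Fintype.card V + Fintype.card E := by positivity
      linarith
    nlinarith
  obtain ⟨⟨h1, h2, h3⟩, ⟨h4, h4'⟩, h5, h6⟩ := hloop.spec hΔ hl hbig hF hf0 hπ
  have hpos : 0 ≤ (2 * Fintype.card V + Fintype.card E + 1 : ℝ) * s.scale := by positivity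
  refine ⟨hsc, h1, h2, fun e he => ?_, ⟨h4, π, hsc ▸ h4'⟩, ?_, fun e he => ?_⟩
  · rcases h3 e he with h | h
    · exact ht h
    -- The threshold `(2n + m + 1) Δ` exceeds `Ex + mΔ`, as `Ex ≤ nΔ` after the main part; it is
    -- tested on the flow before `Extend`.
    · refine hN.mem_tightArcs hΔ hf0 hπ ht (lt_of_le_of_lt ?_ ((hmem e).1 h).2)
      have : 0 ≤ (Fintype.card V : ℝ) * s.scale := by positivity
      nlinarith
  · have : N.excess N.demand s'.flow = N.excess N.demand s.flow := by simp only [excess, h5]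
    rw [this, hsc]; exact hex
  · rw [hsc]
    by_cases hel : e ∈ l
    · rw [(h6 e he).1 hel]; exact hpos
    · rw [(h6 e he).2 hel]
      by_contra hlt
      exact hel ((hmem e).2 ⟨fun h => he (h2 h), not_le.1 hlt⟩)

/-! ### Adjusting the flow -/

theorem exists_adjust {f : E → ℝ} {F : Set E} {Δ : ℝ} (h : N.Feasible F f Δ) :
    ∃ f', N.Adjust (Δ / 2) f F f' := by
  obtain ⟨-, π, hπ⟩ := h
  exact ⟨_, π, by rwa [mul_div_cancel₀ Δ two_ne_zero], fun e => rfl⟩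

/-- The same `π` works. A moved arc inherits one inequality from the old scale, since `f ± δ ± δ = f
± 2δ`, and the other from the test that triggered the move. -/
theorem Standing.feasible_adjust (hN : N.Standing) {f f' : E → ℝ} {F : Set E} {δ : ℝ} (hδ : 0 < δ)
    (hf : N.IsPseudoflow F f) (h : N.Adjust δ f F f') : N.Feasible F f' δ := by
  obtain ⟨π, hπ, hval⟩ := h
  refine ⟨fun e he => ?_, π, feasiblePotential_iff.2 ⟨fun e => ?_, fun e he => ?_⟩⟩
  · have h0 := hf e he
    rw [hval e]
    split_ifs with h1 h2
    · linarith
    · linarith [h2.1.resolve_right he]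
    · exact h0
  · rw [hval e]
    split_ifs with h1 h2
    · rw [add_assoc, ← two_mul]; exact hπ.forward e
    · exact h2.2.le.trans (hN.dcost_mono e (by linarith))
    · exact not_lt.1 h1
  · rw [hval e] at he ⊢
    split_ifs at he ⊢ with h1 h2
    · exact (hN.dcost_mono e (by linarith)).trans h1.le
    · rw [sub_sub, ← two_mul]
      exact hπ.backward (he.imp_right fun h => by linarith)
    · by_contra hlt
      exact h2 ⟨he.symm, not_le.1 hlt⟩

/-! ### Trials -/

theorem abs_compSum_le (b : V → ℝ) (F : Set E) (i : V) : |N.compSum b F i| ≤ N.discrepancy b F :=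
  le_ciSup (f := fun i => |N.compSum b F i|) (Set.finite_range _).bddAbove i

theorem IsCorrection.abs_sub_le {F : Set E} {b' : V → ℝ} (h : N.IsCorrection F b') (i : V) :
    |b' i - N.demand i| ≤ N.discrepancy N.demand F := by
  obtain ⟨r, -, -, hb⟩ := h
  have h1 := N.abs_compSum_le N.demand F i
  rw [hb i, sub_sub_cancel_left, abs_neg]
  split_ifs
  · exact h1
  · rw [abs_zero]; exact (abs_nonneg _).trans h1

theorem Standing.exists_dcost_eq (hN : N.Standing) {e : E} {a b : ℝ} (hab : a ≤ b) {c : ℝ}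
    (h1 : N.dcost e a ≤ c) (h2 : (c : EReal) ≤ N.dcost e b) :
    ∃ y, a ≤ y ∧ y ≤ b ∧ (c : EReal) = N.dcost e y := by
  obtain ⟨y, hy, h⟩ := intermediate_value_Icc hab (hN.dcost_continuous e).continuousOn ⟨h1, h2⟩
  exact ⟨y, hy.1, hy.2, h.symm⟩

/-- The error of the vector computed in a trial. -/
theorem Standing.err_trial_le (hN : N.Standing) {F : Set E} {f : E → ℝ} {Δ : ℝ} (hΔ : 0 < Δ)
    (hF : N.LinearAcyclic F) (hf : N.Feasible F f Δ)
    (hex : N.excess N.demand f ≤ Fintype.card V * Δ)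
    (hsmall : ∀ e, e ∉ F → f e ≤ (2 * Fintype.card V + Fintype.card E + 1) * Δ)
    (hD : N.discrepancy N.demand F ≤ Δ) {b' : V → ℝ} (hb : N.IsCorrection F b') {x : E → ℝ}
    (hx : N.IsTrial F b' x) :
    N.err F x ≤
      ((2 * (2 * Fintype.card V + Fintype.card E + 4) * Fintype.card E * Δ : ℝ) : EReal) := by
  obtain ⟨hf0, π, hπ⟩ := hf
  -- A tight vector for the same `π`: on `F` the two feasibility inequalities bracket `π_j - π_i`,
  -- and the intermediate value theorem gives `y e` within `Δ` of `f e`.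
  have hy : ∀ e, ∃ y : ℝ, (e ∉ F → y = 0) ∧ (e ∈ F → |f e - y| ≤ Δ ∧
      ((π (N.tgt e) - π (N.src e) : ℝ) : EReal) = N.dcost e y) := by
    intro e
    by_cases he : e ∈ F
    · obtain ⟨y, h1, h2, h3⟩ := hN.exists_dcost_eq (by linarith) (hπ.backward (Or.inl he))
        (hπ.forward e)
      exact ⟨y, fun h => absurd he h, fun _ => ⟨abs_le.2 ⟨by linarith, by linarith⟩, h3⟩⟩
    · exact ⟨0, fun _ => rfl, fun h => absurd h he⟩
  choose y hy0 hyF using hy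
  have hyt : N.IsTight F y := ⟨hy0, π, fun e he => (hyF e he).2⟩
  have hn : (Fintype.card V : ℝ) ≤ Fintype.card E := by exact_mod_cast hN.card_le
  have hm : (2 : ℝ) ≤ Fintype.card E := by exact_mod_cast hN.two_le
  have hn0 : (0 : ℝ) ≤ Fintype.card V := by positivity
  set n : ℝ := (Fintype.card V : ℝ) with hn_def
  set m : ℝ := (Fintype.card E : ℝ) with hm_def
  have hfy : ∀ e, |f e - y e| ≤ (2 * n + m + 1) * Δ := by
    intro e
    by_cases he : e ∈ F
    · refine (hyF e he).1.trans ?_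
      nlinarith
    · rw [hy0 e he, sub_zero, abs_of_nonneg (hf0 e he)]
      exact hsmall e he
  -- The correction costs `nΔ`, the imbalance of `f` twice its excess, and passing from `f` to `y`
  -- is counted at both ends of each arc.
  have hdist : ∑ i, |N.netInflow x i - N.netInflow y i| ≤
      (3 * n + 2 * m * (2 * n + m + 1)) * Δ := by
    have h1 : ∑ i, |b' i - N.demand i| ≤ n * Δ := by
      refine (Finset.sum_le_sum fun i _ => (hb.abs_sub_le i).trans hD).trans ?_
      simp [hn_def]
    have h2 : ∑ i, |N.netInflow f i - N.demand i| ≤ 2 * (n * Δ) := by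
      rw [hN.sum_abs_sub_demand]; linarith
    have h3 : ∑ i, |N.netInflow f i - N.netInflow y i| ≤ 2 * (m * ((2 * n + m + 1) * Δ)) := by
      have h4 := N.sum_abs_netInflow_le fun e => f e - y e
      simp only [netInflow_sub] at h4
      refine h4.trans (mul_le_mul_of_nonneg_left ?_ two_pos.le)
      refine (Finset.sum_le_sum fun e _ => hfy e).trans ?_
      simp [hm_def]
    have h5 : ∀ i, |N.netInflow x i - N.netInflow y i| ≤ |b' i - N.demand i| +
        |N.netInflow f i - N.demand i| + |N.netInflow f i - N.netInflow y i| := by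
      intro i
      rw [hx.2 i, abs_sub_comm (N.netInflow f i) (N.demand i)]
      refine le_trans (le_of_eq ?_) (abs_add_three _ _ _)
      congr 1; ring
    refine (Finset.sum_le_sum fun i _ => h5 i).trans ?_
    rw [Finset.sum_add_distrib, Finset.sum_add_distrib]
    nlinarith
  have hxy : ∀ e, |x e - y e| ≤ 2 * (2 * n + m + 4) * m * Δ := by
    intro e
    refine (hN.abs_sub_le_of_isTight hF hx.1 hyt e).trans (hdist.trans ?_)
    nlinarith
  refine err_le (by positivity) ⟨isPseudoflow_of_eq_zero hx.1.1, π, feasiblePotential_iff.2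
    ⟨fun e => ?_, fun e he => ?_⟩⟩
  · by_cases he : e ∈ F
    · rw [(hyF e he).2]
      exact hN.dcost_mono e (by linarith [(abs_le.1 (hxy e)).1])
    · refine (hπ.forward e).trans (hN.dcost_mono e ?_)
      rw [hx.1.1 e he]
      have := hsmall e he
      nlinarith [mul_pos hΔ (by linarith : 0 < 2 * n + m + 4)]
  · have heF : e ∈ F := by
      by_contra hne
      have h1 := he.resolve_left hne
      rw [hx.1.1 e hne] at h1
      exact absurd h1 (not_le.2 (by positivity))
    rw [(hyF e heF).2]
    exact hN.dcost_mono e (by linarith [(abs_le.1 (hxy e)).2])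

/-- A component with a large imbalance is left or entered by an arc of large flow. -/
theorem Standing.exists_boundary_arc (hN : N.Standing) {F : Set E} {f : E → ℝ} {Δ B : ℝ}
    (hB : 0 ≤ B) (hf : N.IsPseudoflow F f) (hex : N.excess N.demand f ≤ Fintype.card V * Δ)
    (hD : 2 * Fintype.card V * Δ + Fintype.card E * B < N.discrepancy N.demand F) :
    ∃ e, e ∉ F ∧ B < f e := by
  classical
  obtain ⟨e₀⟩ : Nonempty E := Fintype.card_pos_iff.1 (by have := hN.two_le; omega)
  have : Nonempty V := ⟨N.src e₀⟩
  obtain ⟨i, hi⟩ := exists_lt_of_lt_ciSup hD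
  set K : Set V := {j | N.Conn F i j} with hK
  set c : E → ℝ := fun e => (if N.tgt e ∈ K then 1 else 0) - if N.src e ∈ K then 1 else 0 with hc
  have hcut : ∑ j with j ∈ K, N.netInflow f j = ∑ e, f e * c e := N.sum_netInflow_cut K f
  have hsum : |N.compSum N.demand F i| ≤
      2 * Fintype.card V * Δ + ∑ e, |f e * c e| := by
    have h1 : N.compSum N.demand F i = ∑ e, f e * c e -
        ∑ j with j ∈ K, (N.netInflow f j - N.demand j) := by
      rw [← hcut, Finset.sum_sub_distrib, sub_sub_cancel]
      unfold compSum
      congr!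
    have h2 : |∑ j with j ∈ K, (N.netInflow f j - N.demand j)| ≤
        ∑ j, |N.netInflow f j - N.demand j| :=
      (Finset.abs_sum_le_sum_abs _ _).trans (Finset.sum_le_sum_of_subset_of_nonneg
        (Finset.filter_subset _ _) fun _ _ _ => abs_nonneg _)
    rw [hN.sum_abs_sub_demand] at h2
    have h3 := Finset.abs_sum_le_sum_abs (fun e => f e * c e) Finset.univ
    rw [h1]
    refine (abs_sub _ _).trans ?_
    linarith
  -- Pigeonhole on the `m` terms of the cut; a nonzero coefficient means that `e` crosses the
  -- boundary of the component, hence lies outside `F`.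
  obtain ⟨e, -, he⟩ : ∃ e ∈ Finset.univ, B < |f e * c e| := by
    refine Finset.exists_lt_of_sum_lt ?_
    rw [Finset.sum_const, nsmul_eq_mul, Finset.card_univ]
    linarith
  have hconn : ¬ N.Conn F (N.src e) (N.tgt e) := by
    intro h
    have h1 : N.tgt e ∈ K ↔ N.src e ∈ K := ⟨fun h2 => .trans _ _ _ h2 (.symm _ _ h),
      fun h2 => .trans _ _ _ h2 h⟩
    have h2 : c e = 0 := by
      simp only [hc, h1, sub_self]
    rw [h2, mul_zero, abs_zero] at he
    linarith
  have heF : e ∉ F := fun h => hconn (.rel _ _ ⟨e, h, rfl, rfl⟩)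
  refine ⟨e, heF, he.trans_le ?_⟩
  have h1 : |c e| ≤ 1 := by
    simp only [hc]
    split_ifs <;> norm_num
  rw [abs_mul, abs_of_nonneg (hf e heF)]
  exact mul_le_of_le_one_right (hf e heF) h1

/-! ### Invariants of an execution -/

theorem Standing.nonempty_nodes (hN : N.Standing) : Nonempty V := by
  obtain ⟨e⟩ : Nonempty E := Fintype.card_pos_iff.1 (by have := hN.two_le; omega)
  exact ⟨N.src e⟩

/-- The invariant of the states between the phases. The last condition says why the current revealed
set has not been tested successfully yet. -/
structure Invariant (N : FlowNetwork V E) (s : State E) : Prop where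
  pos : 0 < s.scale
  feasible : N.Feasible s.revealed s.flow s.scale
  acyclic : N.LinearAcyclic s.revealed
  tight : s.revealed ⊆ N.tightArcs
  progress : 2 * s.scale ≤ N.discrepancy N.demand s.revealed ∨
    ∃ b' x, N.IsCorrection s.revealed b' ∧ N.IsTrial s.revealed b' x ∧
      (s.scale : EReal) ≤ N.err s.revealed x

/-- The invariant of the configurations between the phases. -/
structure GoodConfig (N : FlowNetwork V E) (c : Config E) : Prop where
  acyclic : N.LinearAcyclic c.revealed
  tight : c.revealed ⊆ N.tightArcs
  running : ∀ s, c = .running s → N.Invariant s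
  optimal : ∀ f F, c = .optimal f F → N.FOptimal F f

theorem Invariant.good {s : State E} (h : N.Invariant s) : N.GoodConfig (.running s) :=
  ⟨h.acyclic, h.tight, fun s' hs' => by cases hs'; exact h, fun f F hf => by cases hf⟩

theorem startScale_nonneg (F : Set E) (f : E → ℝ) : 0 ≤ N.startScale F f :=
  le_max_of_le_left (N.err_nonneg F f)

theorem excess_nonpos_of_startScale_nonpos [Nonempty V] {F : Set E} {f : E → ℝ}
    (h : N.startScale F f ≤ 0) : N.err F f = 0 ∧ N.excess N.demand f = 0 := by
  refine ⟨le_antisymm ((le_max_left _ _).trans h) (N.err_nonneg F f), ?_⟩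
  have h1 : ((N.excess N.demand f / (2 * Fintype.card V + N.numNonlinear : ℝ) : ℝ) : EReal) ≤ 0 :=
    (le_max_right _ _).trans h
  have hn : (0 : ℝ) < Fintype.card V := by exact_mod_cast Fintype.card_pos
  have hpos : (0 : ℝ) < 2 * Fintype.card V + N.numNonlinear := by positivity
  rw [← EReal.coe_zero, EReal.coe_le_coe_iff, div_le_iff₀ hpos, zero_mul] at h1
  exact le_antisymm h1 (N.excess_nonneg _ _)

/-- The progress clause follows from whichever term attains the maximum in `startScale`: the error
gives the second alternative, the excess the first. -/
theorem Standing.invariant_of_trial (hN : N.Standing) {F : Set E} {b' : V → ℝ} {x : E → ℝ} {Δ : ℝ}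
    (hF : N.LinearAcyclic F) (ht : F ⊆ N.tightArcs) (hb : N.IsCorrection F b')
    (hx : N.IsTrial F b' x) (hΔ : 0 < Δ) (h : (Δ : EReal) = N.startScale F x) :
    N.Invariant ⟨x, Δ, F⟩ := by
  refine ⟨hΔ, hN.feasible_of_err_le hx.1.1 hΔ ?_, hF, ht, ?_⟩
  · rw [h]; exact le_max_left _ _
  · rcases max_choice (N.err F x)
      ((N.excess N.demand x / (2 * Fintype.card V + N.numNonlinear : ℝ) : ℝ) : EReal) with h1 | h1
    · exact Or.inr ⟨b', x, hb, hx, (h.trans h1).le⟩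
    · left
      have h2 := h.trans h1
      rw [EReal.coe_eq_coe_iff] at h2
      have := hN.nonempty_nodes
      have hn : (0 : ℝ) < Fintype.card V := by exact_mod_cast Fintype.card_pos
      have hpos : (0 : ℝ) < 2 * Fintype.card V + N.numNonlinear := by positivity
      rw [eq_div_iff hpos.ne'] at h2
      -- A trial vector misses each demand by at most the discrepancy. With `(2n + m_N) Δ = Ex` this
      -- yields `2nΔ ≤ nD`.
      have h3 : N.excess N.demand x ≤ Fintype.card V * N.discrepancy N.demand F := by
        refine (Finset.sum_le_sum (g := fun _ => N.discrepancy N.demand F) fun i _ => ?_).trans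
          (le_of_eq ?_)
        · have h4 := hb.abs_sub_le i
          rw [← hx.2 i] at h4
          exact max_le ((le_abs_self _).trans h4) ((abs_nonneg _).trans h4)
        · simp
      have h5 : 0 ≤ Δ * N.numNonlinear := by positivity
      have h6 : Fintype.card V * (2 * Δ) ≤ Fintype.card V * N.discrepancy N.demand F := by
        linarith
      exact le_of_mul_le_mul_left h6 hn

theorem conn_empty {i j : V} : N.Conn ∅ i j ↔ i = j := by
  constructor
  · intro h
    induction h with
    | rel _ _ h => obtain ⟨e, he, -⟩ := h; exact absurd he (notMem_empty e)
    | refl => rfl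
    | symm _ _ _ ih => exact ih.symm
    | trans _ _ _ _ _ ih1 ih2 => exact ih1.trans ih2
  · rintro rfl; exact .refl _

/-- Components of `∅` are single nodes, so the corrected demands vanish and the zero flow is a trial
vector: the initial state is handled like a successful trial. -/
theorem isCorrection_empty : N.IsCorrection ∅ 0 := by
  refine ⟨id, fun i => .refl _, fun i j h => conn_empty.1 h, fun i => ?_⟩
  have : N.compSum N.demand ∅ i = N.demand i := by
    rw [compSum, Finset.sum_filter, Finset.sum_eq_single i (fun j _ h => if_neg fun h' =>
      h (conn_empty.1 h').symm) (by simp), if_pos (.refl _)]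
  simp [this]

theorem isTrial_empty : N.IsTrial ∅ 0 0 :=
  ⟨⟨fun _ _ => rfl, 0, fun e he => absurd he (notMem_empty e)⟩, fun i => netInflow_zero i⟩

theorem Standing.good_of_initial (hN : N.Standing) {c : Config E} (h : N.Initial c) :
    N.GoodConfig c := by
  have := hN.nonempty_nodes
  cases h with
  | running Δ hΔ h =>
    exact (hN.invariant_of_trial linearAcyclic_empty (empty_subset _) isCorrection_empty
      isTrial_empty hΔ h).good
  | optimal h =>
    refine ⟨linearAcyclic_empty, empty_subset _, fun s hs => (by cases hs), fun f F hf => ?_⟩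
    cases hf
    obtain ⟨h1, h2⟩ := excess_nonpos_of_startScale_nonpos h.le
    exact hN.fOptimal_of_err_eq_zero (fun _ _ => rfl) h1 h2
  | unbounded _ =>
    exact ⟨linearAcyclic_empty, empty_subset _, fun s hs => (by cases hs), fun f F hf => by cases hf⟩

theorem exists_initial : ∃ c, N.Initial c := by
  by_cases h1 : N.err ∅ 0 = ⊤
  · exact ⟨_, .unbounded h1⟩
  rcases (N.startScale_nonneg ∅ 0).eq_or_lt with h2 | h2
  · exact ⟨_, .optimal h2.symm⟩
  · have htop : N.startScale ∅ 0 ≠ ⊤ :=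
      (max_lt (lt_top_iff_ne_top.2 h1) (EReal.coe_lt_top _)).ne
    have h3 := EReal.coe_toReal htop (ne_bot_of_gt h2)
    refine ⟨_, .running (N.startScale ∅ 0).toReal ?_ h3⟩
    rwa [← EReal.coe_pos, h3]

theorem AfterExtend.revealed_eq {s s' : State E} {c : Config E} (h : N.AfterExtend s s' c) :
    c.revealed = s'.revealed := by
  cases h <;> rfl

theorem Invariant.extendSpec (hN : N.Standing) {s t t' : State E} (h : N.Invariant s)
    (hst : Relation.ReflTransGen N.Augment s t) (hm : N.MainDone t) (he : N.Extend t t') :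
    t'.scale = s.scale ∧ t.revealed = s.revealed ∧ N.ExtendSpec t t' := by
  obtain ⟨h1, h2, h3⟩ := hN.feasible_of_augment h.pos h.feasible hst
  have h4 := hN.extendSpec (h1 ▸ h.pos) h3 (h2 ▸ h.acyclic) (h2 ▸ h.tight) hm he
  exact ⟨h4.scale_eq.trans h1, h2, h4⟩

/-- For the progress clause: if `F` is unchanged, the old reason survives halving; if it grew
without a trial, `D > Δ`, twice the new scale; a failed trial leaves a vector of error at least
`Δ/2`; a successful one falls under `Standing.invariant_of_trial`. -/
theorem Invariant.good_afterExtend (hN : N.Standing) {s t t' : State E} {c : Config E}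
    (h : N.Invariant s) (h1 : t'.scale = s.scale) (h2 : t.revealed = s.revealed)
    (h3 : N.ExtendSpec t t') (ha : N.AfterExtend t t' c) : N.GoodConfig c := by
  have hpos : 0 < t'.scale := h1 ▸ h.pos
  have := hN.nonempty_nodes
  cases ha with
  | adjust f hc hadj =>
    refine Invariant.good ⟨half_pos hpos, hN.feasible_adjust (half_pos hpos) h3.feasible.1 hadj,
      h3.acyclic, h3.tight, ?_⟩
    by_cases heq : t'.revealed = t.revealed
    · have h4 := h.progress
      rw [← h2, ← heq, ← h1] at h4
      refine h4.imp (fun h5 => ?_) fun ⟨b', x, h5, h6, h7⟩ => ⟨b', x, h5, h6, le_trans ?_ h7⟩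
      · show 2 * (t'.scale / 2) ≤ N.discrepancy N.demand t'.revealed
        linarith
      · exact EReal.coe_le_coe_iff.2 (half_le_self hpos.le)
    · left
      have h5 : t'.scale < N.discrepancy N.demand t'.revealed :=
        not_le.1 fun h6 => hc ⟨heq, h6⟩
      show 2 * (t'.scale / 2) ≤ N.discrepancy N.demand t'.revealed
      linarith
  | trialOptimal b' x _ _ hx hb herr =>
    refine ⟨h3.acyclic, h3.tight, fun s hs => (by cases hs), fun f F hf => ?_⟩
    cases hf
    refine hN.fOptimal_of_err_eq_zero hx.1.1 herr ?_
    simp [excess, hx.2, hb]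
  | trialFailure b' x f _ hb hx herr hadj =>
    exact Invariant.good ⟨half_pos hpos, hN.feasible_adjust (half_pos hpos) h3.feasible.1 hadj,
      h3.acyclic, h3.tight, Or.inr ⟨b', x, hb, hx, herr⟩⟩
  | trialSuccess b' x Δ _ hb hx hne _ hΔ =>
    refine (hN.invariant_of_trial h3.acyclic h3.tight hb hx ?_ hΔ).good
    by_contra hle
    have h4 : N.startScale t'.revealed x ≤ 0 := by
      rw [← hΔ, ← EReal.coe_zero, EReal.coe_le_coe_iff]
      exact not_lt.1 hle
    obtain ⟨h5, h6⟩ := excess_nonpos_of_startScale_nonpos h4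
    exact hne ⟨funext fun i => by rw [← hx.2 i, hN.netInflow_eq_of_excess_eq_zero h6], h5⟩

theorem GoodConfig.phase (hN : N.Standing) {c c' : Config E} (h : N.GoodConfig c)
    (hp : N.Phase c c') : N.GoodConfig c' ∧ c.revealed ⊆ c'.revealed := by
  obtain ⟨s, t, rfl, hst, hm, t', he, ha⟩ := hp
  have hs := h.running s rfl
  obtain ⟨h1, h2, h3⟩ := hs.extendSpec hN hst hm he
  refine ⟨hs.good_afterExtend hN h1 h2 h3 ha, ?_⟩
  rw [ha.revealed_eq]
  exact h2.symm.subset.trans h3.subset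

theorem IsRun.good (hN : N.Standing) {K : ℕ} {c : ℕ → Config E} (h : N.IsRun K c) {k : ℕ}
    (hk : k ≤ K) : N.GoodConfig (c k) := by
  induction k with
  | zero => exact hN.good_of_initial h.1
  | succ k ih => exact ((ih (by omega)).phase hN (h.2 k (by omega))).1

theorem IsRun.revealed_subset (hN : N.Standing) {K : ℕ} {c : ℕ → Config E} (h : N.IsRun K c)
    {j k : ℕ} (hjk : j ≤ k) (hk : k ≤ K) : (c j).revealed ⊆ (c k).revealed := by
  induction k, hjk using Nat.le_induction with
  | base => exact Subset.rfl
  | succ k _ ih =>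
    exact (ih (by omega)).trans ((h.good hN (by omega)).phase hN (h.2 k (by omega))).2

/-! ### Totality of a phase -/

theorem exists_correction (F : Set E) :
    ∃ b', N.IsCorrection F b' ∧ N.discrepancy b' F = 0 := by
  classical
  let S : Setoid V := Relation.EqvGen.setoid fun a b => ∃ e ∈ F, N.src e = a ∧ N.tgt e = b
  let r : V → V := fun i => (Quotient.mk S i).out
  have hr1 : ∀ i, N.Conn F i (r i) := fun i => .symm _ _ (Quotient.exact (Quotient.out_eq (Quotient.mk S i)))
  have hr2 : ∀ i j, N.Conn F i j → r i = r j := fun i j h =>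
    congrArg Quotient.out (Quotient.sound (s := S) h)
  have hcomp : ∀ i j, N.Conn F i j → N.compSum N.demand F i = N.compSum N.demand F j := by
    intro i j h
    unfold compSum
    congr 1
    ext k
    simp only [Finset.mem_filter, Finset.mem_univ, true_and]
    exact ⟨fun h' => .trans _ _ _ (.symm _ _ h) h', fun h' => .trans _ _ _ h h'⟩
  refine ⟨_, ⟨r, hr1, hr2, fun i => rfl⟩, ?_⟩
  have hzero : ∀ i, N.compSum (fun i => N.demand i - if r i = i then N.compSum N.demand F i else 0)
      F i = 0 := by
    intro i
    rw [compSum, Finset.sum_sub_distrib, sub_eq_zero, Finset.sum_eq_single (r i)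
      (f := fun j => if r j = j then N.compSum N.demand F j else 0)]
    · rw [if_pos (hr2 _ _ (.symm _ _ (hr1 i))), ← hcomp i (r i) (hr1 i)]
      rfl
    · intro j hj hne
      refine if_neg fun h => hne ?_
      rw [← h]
      exact (hr2 _ _ (Finset.mem_filter.1 hj).2).symm
    · intro h
      exact absurd (Finset.mem_filter.2 ⟨Finset.mem_univ _, hr1 i⟩) h
  unfold discrepancy
  simp only [hzero, abs_zero]
  exact Real.iSup_const_zero

theorem exists_afterExtend (hT : N.TrialSolvable) {t t' : State E}
    (h : N.ExtendSpec t t') : ∃ c, N.AfterExtend t t' c := by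
  by_cases hc : N.CallsTrial t t'
  · obtain ⟨b', hb, hD⟩ := N.exists_correction t'.revealed
    obtain ⟨x, hx⟩ := hT _ b' h.acyclic hD
    by_cases hopt : N.demand = b' ∧ N.err t'.revealed x = 0
    · exact ⟨_, .trialOptimal b' x hc hb hx hopt.1 hopt.2⟩
    rcases lt_or_ge (N.err t'.revealed x) ((t'.scale / 2 : ℝ) : EReal) with herr | herr
    · have htop : N.startScale t'.revealed x ≠ ⊤ :=
        (max_lt (herr.trans (EReal.coe_lt_top _)) (EReal.coe_lt_top _)).ne
      have hbot : N.startScale t'.revealed x ≠ ⊥ :=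
        (ne_bot_of_le_ne_bot EReal.zero_ne_bot (N.startScale_nonneg _ _))
      exact ⟨_, .trialSuccess b' x _ hc hb hx hopt herr (EReal.coe_toReal htop hbot)⟩
    · obtain ⟨f, hf⟩ := exists_adjust h.feasible
      exact ⟨_, .trialFailure b' x f hc hb hx herr hf⟩
  · obtain ⟨f, hf⟩ := exists_adjust h.feasible
    exact ⟨_, .adjust f hc hf⟩

theorem Invariant.augment_or_endPhase (hN : N.Standing) (hT : N.TrialSolvable) {s t : State E}
    (h : N.Invariant s) (hst : Relation.ReflTransGen N.Augment s t) :
    (∃ t', N.Augment t t') ∨ ∃ c, N.EndPhase t c := by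
  refine (hN.augment_or_mainDone t).imp_right fun hm => ?_
  obtain ⟨-, h2, -⟩ := hN.feasible_of_augment h.pos h.feasible hst
  obtain ⟨t', he⟩ := exists_extend (s := t) (h2 ▸ h.acyclic)
  obtain ⟨c, hc⟩ := exists_afterExtend hT (h.extendSpec hN hst hm he).2.2
  exact ⟨c, hm, t', he, hc⟩

/-! ### The number of phases -/

/-- A larger discrepancy would force an unrevealed arc above the `Extend` threshold. -/
theorem ExtendSpec.discrepancy_le (hN : N.Standing) {t t' : State E} (h : N.ExtendSpec t t')
    (hpos : 0 < t'.scale) : N.discrepancy N.demand t'.revealed ≤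
      2 * Fintype.card V * t'.scale +
        Fintype.card E * ((2 * Fintype.card V + Fintype.card E + 1) * t'.scale) := by
  by_contra hlt
  obtain ⟨e, he, hlt⟩ := hN.exists_boundary_arc (by positivity) h.feasible.1 h.excess_le
    (not_le.1 hlt)
  exact absurd (h.small e he) (not_le.2 hlt)

theorem Standing.le_two_pow_logT (hN : N.Standing) :
    (8 * (2 * Fintype.card V + Fintype.card E + 4) * Fintype.card E : ℝ) ≤ 2 ^ N.logT := by
  have hm : (2 : ℝ) ≤ Fintype.card E := by exact_mod_cast hN.two_le
  have hT : (0 : ℝ) < 8 * (2 * Fintype.card V + Fintype.card E + 4) * Fintype.card E := by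
    positivity
  rw [← Real.rpow_natCast, ← Real.logb_le_iff_le_rpow one_lt_two hT]
  exact Nat.le_ceil _

/-- Within `2 ⌈log₂ T⌉` phases a new arc is revealed. -/
theorem IsRun.ssubset (hN : N.Standing) {K : ℕ} {c : ℕ → Config E} (h : N.IsRun K c) {k : ℕ}
    (hk : k + 2 * N.logT ≤ K) : (c k).revealed ⊂ (c (k + 2 * N.logT)).revealed := by
  refine (h.revealed_subset hN (by omega) hk).ssubset_of_ne fun heq => ?_
  set F := (c k).revealed with hF
  have hrev : ∀ i ≤ 2 * N.logT, (c (k + i)).revealed = F := fun i hi => Subset.antisymm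
    (heq ▸ h.revealed_subset hN (by omega) hk) (h.revealed_subset hN (by omega) (by omega))
  have hm : (2 : ℝ) ≤ Fintype.card E := by exact_mod_cast hN.two_le
  have hn : (Fintype.card V : ℝ) ≤ Fintype.card E := by exact_mod_cast hN.card_le
  have hn0 : (0 : ℝ) ≤ Fintype.card V := by positivity
  have hpow := hN.le_two_pow_logT
  have hL : 0 < N.logT := by
    by_contra h0
    rw [Nat.eq_zero_of_not_pos h0, pow_zero] at hpow
    nlinarith
  obtain ⟨s₀, -, hs₀, -⟩ := h.2 k (by omega)
  have hinv₀ := (h.good hN (by omega)).running s₀ hs₀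
  have hF₀ : s₀.revealed = F := by rw [hF, hs₀]; rfl
  -- With `F` constant no trial is called, so every phase of the window but the last ends with
  -- `Adjust` and a running state at half the scale.
  have hstep : ∀ i < 2 * N.logT, ∃ s t t', c (k + i) = .running s ∧ s.scale = s₀.scale / 2 ^ i ∧
      t'.scale = s.scale ∧ t'.revealed = F ∧ t.revealed = F ∧ N.ExtendSpec t t' ∧
      N.AfterExtend t t' (c (k + i + 1)) := by
    intro i
    induction i with
    | zero =>
      intro hi
      obtain ⟨s, t, hs, hst, hm', t', he, ha⟩ := h.2 (k + 0) (by omega)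
      obtain rfl : s = s₀ := by
        have := hs.symm.trans hs₀
        injection this
      obtain ⟨h1, h2, h3⟩ := hinv₀.extendSpec hN hst hm' he
      exact ⟨s, t, t', hs, by simp, h1, by rw [← ha.revealed_eq]; exact hrev 1 (by omega),
        h2.trans hF₀, h3, ha⟩
    | succ i ih =>
      intro hi
      obtain ⟨s, t, t', hs, hsc, h1, h2, h3, h4, h5⟩ := ih (by omega)
      obtain ⟨s', u, hs', hsu, hm', u', he, ha⟩ := h.2 (k + (i + 1)) (by omega)
      have hinv := (h.good hN (k := k + (i + 1)) (by omega)).running s' hs'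
      obtain ⟨g1, g2, g3⟩ := hinv.extendSpec hN hsu hm' he
      have hsF : s'.revealed = F := by
        rw [← hrev (i + 1) (by omega), hs']; rfl
      have hnc : ¬ N.CallsTrial t t' := fun hc => hc.1 (h2.trans h3.symm)
      have hsc' : s'.scale = s.scale / 2 := by
        rw [show k + i + 1 = k + (i + 1) by omega, hs'] at h5
        cases h5 with
        | adjust => rw [h1]
        | trialFailure _ _ _ hc => exact absurd hc hnc
        | trialSuccess _ _ _ hc => exact absurd hc hnc
      refine ⟨s', u, u', hs', ?_, g1, ?_, g2.trans hsF, g3, ha⟩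
      · rw [hsc', hsc, pow_succ, div_div]
      · rw [← ha.revealed_eq]; exact hrev (i + 2) (by omega)
  set Q : ℝ := 2 ^ N.logT with hQ
  have hQ0 : 0 < Q := by positivity
  have hQ1 : 1 ≤ Q := by nlinarith
  have hΔ := hinv₀.pos
  -- Read off in the last phase of the window, at scale `2Δ₀ / Q²`, where the discrepancy is at most
  -- `Q/2` times the scale.
  have hD : N.discrepancy N.demand F ≤ s₀.scale / Q := by
    obtain ⟨s, t, t', -, hsc, h1, h2, -, h4, -⟩ := hstep (2 * N.logT - 1) (by omega)
    have hpw : (2 : ℝ) ^ (2 * N.logT - 1) = Q * Q / 2 := by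
      rw [eq_div_iff two_ne_zero, ← pow_succ, hQ, ← pow_add]
      congr 1; omega
    rw [hpw, ← h1] at hsc
    have hpos : 0 < t'.scale := by rw [hsc]; positivity
    have h5 := h4.discrepancy_le hN hpos
    rw [h2] at h5
    have h6 : s₀.scale = t'.scale * (Q * Q / 2) := by rw [hsc]; field_simp
    rw [h6, le_div_iff₀ hQ0]
    refine (mul_le_mul_of_nonneg_right h5 hQ0.le).trans ?_
    have h7 : 2 * (Fintype.card V : ℝ) + Fintype.card E * (2 * Fintype.card V + Fintype.card E + 1)
        ≤ Q / 2 := by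
      nlinarith
    have h8 := mul_le_mul_of_nonneg_right h7 (mul_pos hpos hQ0).le
    linarith
  have hDlt : s₀.scale / Q ≤ s₀.scale := div_le_self hΔ.le hQ1
  rcases hinv₀.progress with hp | ⟨b', x, hb, hx, herr⟩
  · rw [hF₀] at hp
    linarith
  · rw [hF₀] at hb hx herr
    -- Halfway the scale is `Δ₀ / Q`, which `hD` shows to be at least `D`. The error bound for the
    -- old `x` is then `T/4 ≤ Q/4` times the scale, that is at most `Δ₀/4`, against `herr`.
    obtain ⟨s, t, t', -, hsc, h1, h2, -, h4, -⟩ := hstep N.logT (by omega)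
    rw [← h1] at hsc
    have hpos : 0 < t'.scale := by rw [hsc]; positivity
    have h5 := hN.err_trial_le hpos h4.acyclic h4.feasible h4.excess_le h4.small
      (by rw [h2, hsc]; exact hD) (h2.symm ▸ hb) (h2.symm ▸ hx)
    rw [h2] at h5
    have h6 := EReal.coe_le_coe_iff.1 (herr.trans h5)
    have h7 : s₀.scale = t'.scale * Q := by rw [hsc, hQ]; field_simp
    have h8 := mul_le_mul_of_nonneg_right hpow hpos.le
    nlinarith [mul_pos hpos hQ0]

theorem IsRun.ncard_extensions_le (hN : N.Standing) {K : ℕ} {c : ℕ → Config E} (h : N.IsRun K c)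
    {j : ℕ} (hj : j ≤ K) :
    {k : ℕ | k < j ∧ (c (k + 1)).revealed ≠ (c k).revealed}.ncard ≤ (c j).revealed.ncard := by
  induction j with
  | zero => simp
  | succ j ih =>
    have ih := ih (by omega)
    have hsub : (c j).revealed ⊆ (c (j + 1)).revealed := h.revealed_subset hN (Nat.le_succ j) hj
    by_cases heq : (c (j + 1)).revealed = (c j).revealed
    · have : {k : ℕ | k < j + 1 ∧ (c (k + 1)).revealed ≠ (c k).revealed} =
          {k : ℕ | k < j ∧ (c (k + 1)).revealed ≠ (c k).revealed} := by
        ext k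
        refine and_congr_left fun hk => ?_
        have : k ≠ j := by rintro rfl; exact hk heq
        omega
      rw [this, heq]
      exact ih
    · have hss : {k : ℕ | k < j + 1 ∧ (c (k + 1)).revealed ≠ (c k).revealed} ⊆
          insert j {k : ℕ | k < j ∧ (c (k + 1)).revealed ≠ (c k).revealed} := by
        rintro k ⟨h1, h2⟩
        rcases Nat.lt_succ_iff_lt_or_eq.1 h1 with h1 | h1
        exacts [Or.inr ⟨h1, h2⟩, Or.inl h1]
      have hfin : {k : ℕ | k < j ∧ (c (k + 1)).revealed ≠ (c k).revealed}.Finite :=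
        (finite_lt_nat j).subset fun k hk => hk.1
      have h1 := (ncard_le_ncard hss (hfin.insert j)).trans (ncard_insert_le _ _)
      have h2 := ncard_lt_ncard (hsub.ssubset_of_ne (Ne.symm heq)) (toFinite _)
      omega

/-- Every window of `2⌈log₂ T⌉` phases reveals an arc, and there is room for fewer than `n + m_N` of
them. -/
theorem IsRun.le_mul (hN : N.Standing) {K : ℕ} {c : ℕ → Config E} (h : N.IsRun K c) :
    K ≤ 2 * N.logT * (Fintype.card V + N.numNonlinear) := by
  have := hN.nonempty_nodes
  have key : ∀ q : ℕ, 2 * N.logT * q ≤ K → q ≤ (c (2 * N.logT * q)).revealed.ncard := by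
    intro q
    induction q with
    | zero => simp
    | succ q ih =>
      intro hq
      rw [Nat.mul_succ] at hq ⊢
      have h1 := ncard_lt_ncard (h.ssubset hN hq) (toFinite _)
      have := ih (by omega)
      omega
  by_contra hlt
  have h1 := key (Fintype.card V + N.numNonlinear) (by omega)
  have h2 := (h.good hN (k := 2 * N.logT * (Fintype.card V + N.numNonlinear)) (by omega)).acyclic.ncard_lt
  omega

theorem Standing.logT_le (hN : N.Standing) :
    (N.logT : ℝ) ≤ 9 / Real.log 2 * Real.log (Fintype.card E) := by
  have hm : (2 : ℝ) ≤ Fintype.card E := by exact_mod_cast hN.two_le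
  have hn : (Fintype.card V : ℝ) ≤ Fintype.card E := by exact_mod_cast hN.card_le
  have hn0 : (0 : ℝ) ≤ Fintype.card V := by positivity
  set m : ℝ := (Fintype.card E : ℝ) with hm_def
  set T : ℝ := 8 * (2 * Fintype.card V + m + 4) * m with hT
  have hT1 : 1 ≤ T := by nlinarith
  -- `T ≤ 40m² ≤ 2⁶m² ≤ m⁸`, by `n ≤ m` and `2 ≤ m`. Rounding up costs at most one more `log₂ m`,
  -- whence the factor `9`.
  have hTm : T ≤ m ^ 8 := by
    have h1 : T ≤ 40 * m ^ 2 := by nlinarith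
    have h2 : (2 : ℝ) ^ 6 ≤ m ^ 6 := pow_le_pow_left₀ (by norm_num) hm 6
    have h3 : m ^ 8 = m ^ 6 * m ^ 2 := by ring
    rw [h3]
    nlinarith [sq_nonneg m]
  have hlog2 : 0 < Real.log 2 := Real.log_pos one_lt_two
  have hlogm : Real.log 2 ≤ Real.log m := Real.log_le_log two_pos hm
  have h4 : Real.logb 2 T ≤ 8 * Real.log m / Real.log 2 := by
    rw [Real.logb]
    have := Real.log_le_log (by linarith) hTm
    rw [Real.log_pow] at this
    push_cast at this
    gcongr
  have h5 : (N.logT : ℝ) < Real.logb 2 T + 1 :=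
    Nat.ceil_lt_add_one (Real.logb_nonneg one_lt_two hT1)
  have h6 : 1 ≤ Real.log m / Real.log 2 := (one_le_div hlog2).2 hlogm
  calc (N.logT : ℝ) ≤ 8 * Real.log m / Real.log 2 + Real.log m / Real.log 2 := by linarith
    _ = 9 / Real.log 2 * Real.log m := by ring

end FlowNetwork

end

theorem mainTheorem2 :
    ∃ C : ℝ, ∀ (V : Type u) (E : Type v) [Fintype V] [Fintype E] (N : FlowNetwork V E),
      N.Standing → N.TrialSolvable →
      (∃ c₀, N.Initial c₀) ∧
      (∀ (K : ℕ) (c : ℕ → FlowNetwork.Config E), N.IsRun K c →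
        -- the number of scaling phases
        (K : ℝ) ≤ C * (Fintype.card V + N.numNonlinear : ℝ) * Real.log (Fintype.card E : ℝ) ∧
        -- the revealed arcs
        (∀ k ≤ K, (c k).revealed ⊆ N.tightArcs) ∧
        Set.ncard {k : ℕ | k < K ∧ (c (k + 1)).revealed ≠ (c k).revealed} + 1 ≤
          Fintype.card V + N.numNonlinear ∧
        (∀ k : ℕ, k + 2 * N.logT ≤ K → (c k).revealed ⊂ (c (k + 2 * N.logT)).revealed) ∧
        -- an execution cannot loop inside a phase, get stuck, or stop with a wrong result
        (∀ s, c K = .running s →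
          (¬ ∃ t : ℕ → FlowNetwork.State E, t 0 = s ∧ ∀ j, N.Augment (t j) (t (j + 1))) ∧
          ∀ t, Relation.ReflTransGen N.Augment s t →
            (∃ t', N.Augment t t') ∨ ∃ c', N.EndPhase t c') ∧
        (∀ f F, c K = .optimal f F → N.FOptimal F f) ∧
        -- the error of the vector computed in a trial
        (∀ (s t t' : FlowNetwork.State E) (b' : V → ℝ) (x : E → ℝ),
          c K = .running s → Relation.ReflTransGen N.Augment s t → N.MainDone t →
          N.Extend t t' → N.CallsTrial t t' →
          N.IsCorrection t'.revealed b' → N.IsTrial t'.revealed b' x →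
          N.err t'.revealed x ≤
            ((2 * (2 * Fintype.card V + Fintype.card E + 4) * Fintype.card E * s.scale : ℝ) :
              EReal))) ∧
      -- the distance of two tight vectors
      ∀ (F : Set E) (x y : E → ℝ), N.LinearAcyclic F → N.IsTight F x → N.IsTight F y →
        ∀ e, |x e - y e| ≤ ∑ i, |N.netInflow x i - N.netInflow y i| := by
  -- Windows have length `2 ⌈log₂ T⌉`, so the constant is twice that of `logT_le`.
  refine ⟨18 / Real.log 2, fun V E _ _ N hN hT => ⟨N.exists_initial, fun K c h => ?_,
    fun F x y hF hx hy => hN.abs_sub_le_of_isTight hF hx hy⟩⟩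
  have := hN.nonempty_nodes
  refine ⟨?_, fun k hk => (h.good hN hk).tight, ?_, fun k hk => h.ssubset hN hk,
    fun s hs => ⟨?_, fun t hst => ?_⟩, fun f F hf => (h.good hN le_rfl).optimal f F hf, ?_⟩
  · have h1 : (K : ℝ) ≤ 2 * N.logT * (Fintype.card V + N.numNonlinear) := by
      exact_mod_cast h.le_mul hN
    refine h1.trans ?_
    have h2 := mul_le_mul_of_nonneg_right hN.logT_le
      (by positivity : (0 : ℝ) ≤ 2 * (Fintype.card V + N.numNonlinear))
    calc _ = (N.logT : ℝ) * (2 * (Fintype.card V + N.numNonlinear)) := by ring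
      _ ≤ _ := h2
      _ = _ := by ring
  · have h1 := h.ncard_extensions_le hN le_rfl
    have h2 := (h.good hN le_rfl).acyclic.ncard_lt
    omega
  · rintro ⟨t, rfl, ht⟩
    exact FlowNetwork.not_forall_augment ((h.good hN le_rfl).running _ hs).pos ht
  · exact ((h.good hN le_rfl).running s hs).augment_or_endPhase hN hT hst
  · intro s t t' b' x hs hst hm he hc hb hx
    have hinv := (h.good hN le_rfl).running s hs
    obtain ⟨h1, -, h3⟩ := hinv.extendSpec hN hst hm he
    rw [← h1]
    exact hN.err_trial_le (h1 ▸ hinv.pos) h3.acyclic h3.feasible h3.excess_le h3.small hc.2 hb hx
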